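/- **Model.** $n\ge 1$ processes communicate through atomic read/write registers. Each process alternates between coin flip steps and shared memory steps (reads or writes), starting with a coin flip. Coin flips are private, independent, and take values in a countable space $\Omega$ with a fixed distribution $\mathcal D$. A process that has finished makes a no-op when scheduled. An execution is the sequence of the steps taken (process, type of step, register, value). An adversary maps each finite execution of an algorithm to the process that takes the next step; an algorithm $M$ and an adversary $A$ thus yield a random execution $\mathcal E_{M,A}$. The adversary $A$ is *r/w-oblivious* for $M$ if its choice after a finite execution $\mathcal E$ of $M$ depends only on (i) the schedule of $\mathcal E$, (ii) for each process $p$, the results of the coin flips of $p$ that precede $p$'s latest shared memory step in $\mathcal E$, and (iii) for each process whose next step is a shared memory step, the register it will access. **The algorithm.** Let $b=3/2$, $q_i=2^{-b^{\,i-1}}$ for $i\ge1$, and $\ell=\lceil\log_b\log_2 n\rceil$ (put $\ell=1$ if $n\le 2$). The shared registers $Up[1..\ell]$ and $Down[1..\ell-1]$ are initially $0$. The method $\mathrm{elect}()$ is as follows. * Backward phase: for $i=1,2,\dots$, choose heads with probability $q_i$ and tails otherwise. On heads, write $1$ to $Up[i]$, and then continue with $i+1$ if $i<\ell$, or end the phase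 if $i=\ell$. On tails, read $Up[i]$; if the value is $1$, return *lose*, otherwise end the phase. * Forward phase: let $j$ be the index at which the backward phase ended. For $i=j-1,j-2,\dots,1$, choose heads with probability $q_i$ and tails otherwise. On heads, write $1$ to $Down[i]$. On tails, read $Down[i]$; if the value is $1$, return *lose*. * Return *win*. **Measures.** Let $M$ be any $n$-process algorithm, possibly using other registers, in which each process calls $\mathrm{elect}()$ of one such object at most once in every execution. For $1\le k\le n$ let $\mathrm{Exec}_{M,A}(k)$ be the set of finite executions $\mathcal E'$ that can result for $A$, that end when the first process becomes poised to invoke $\mathrm{elect}()$, and such that in every execution of $M$ extending $\mathcal E'$ at most $k$ processes invoke $\mathrm{elect}()$. The effectiveness in $M$ against $A$ is $$\varphi(k)=\sup_{\mathcal E'\in \mathrm{Exec}_{M,A}(k)}\mathbb E\bigl[\#\{p:\ p\text{'s call returns } win\}\ \big|\ \mathcal E_{M,A}\text{ extends }\mathcal E'\bigr],$$ and the (adaptive) expected max-step complexity is $$\tau(k)=\sup_{\mathcal E'\in \mathrm{Exec}_{M,A}(k)}\mathbb E\bigl[\max_p T_p\ \big|\ \mathcal E_{M,A}\text{ extends }\mathcal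 E'\bigr],$$ where $T_p$ is the number of shared memory steps that $p$ makes during its call of $\mathrm{elect}()$. **Lemma.** The algorithm implements group election: in every execution of every such $M$ in which at least one process calls $\mathrm{elect}()$ and all calls of $\mathrm{elect}()$ return, at least one call returns *win*. Moreover, for every such $M$, every r/w-oblivious adversary $A$ for $M$, and every $1\le k\le n$: 1. $\varphi(k)\le 16$; 2. $\tau(k)\le 2\lceil\log_{3/2}\log_2\max\{k,2\}\rceil+7$; 3. $\tau(k)\le C\log_2\log_2 k$ if $k\ge3$, where $C$ is an absolute constant; that is, the expected max-step complexity is $O(\log\log k)$. -/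

import Mathlib

namespace GroupElect

open MeasureTheory ProbabilityTheory
open scoped ENNReal

/-- The two possible return values of `elect()`. -/
inductive Outcome
  | win
  | lose

/-- A shared memory step on registers `X` storing values in `Y`, followed by local computation
that leads to a result in `T`. -/
inductive Op (X Y T : Type*)
  | read (x : X) (cont : Y → T)
  | write (x : X) (v : Y) (next : T)

/-- The register accessed by a shared memory step. -/
def Op.reg {X Y T : Type*} : Op X Y T → X
  | .read x _ => x
  | .write x _ _ => x

/-- An implementation of the one-time method `elect()` from registers `R` storing values in `W`.
In local state `q : Q` the process makes a coin flip `w` and then the shared memory step `act q w`,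
after which it is either in a new local state or `elect()` returns. -/
structure Impl (Ω Q R W : Type*) where
  start : Q
  init : R → W
  act : Q → Ω → Op R W (Q ⊕ Outcome)

/-- What a process does next in its own code: it has finished, or it makes a coin flip followed by
a shared memory step on the registers `L` of the algorithm, or it calls `elect()` and continues
according to the outcome. -/
inductive Action (Ω L V S : Type*)
  | halt
  | flip (op : Ω → Op L V S)
  | call (cont : Outcome → S)

/-- An `n`-process algorithm that uses one group election object. `S` is the type of local states,
`L` the type of the algorithm's other registers, which store values in `V`. -/
structure Algo (n : ℕ) (Ω L V S : Type*) where
  start : Fin n → S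
  init : L → V
  next : Fin n → S → Action Ω L V S

/-- Control state of a process: in its own code (`code`), in its own code between a coin flip and
the subsequent shared memory step (`codeOp`), inside its `elect()` call before a coin flip (`meth`),
inside its `elect()` call between a coin flip and the subsequent shared memory step (`methOp`). -/
inductive Ctl (L V S Q R W : Type*)
  | code (s : S)
  | codeOp (op : Op L V S)
  | meth (q : Q) (cont : Outcome → S)
  | methOp (op : Op R W (Q ⊕ Outcome)) (cont : Outcome → S)

/-- What happens in a step. A process that has finished makes a no-op when it is scheduled. -/
inductive Event (Ω L V R W : Type*)
  | flip (w : Ω)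
  | read (x : L ⊕ R) (v : V ⊕ W)
  | write (x : L ⊕ R) (v : V ⊕ W)
  | noop

/-- Whether the step is a shared memory step. -/
def Event.isMem {Ω L V R W : Type*} : Event Ω L V R W → Bool
  | .read _ _ => true
  | .write _ _ => true
  | _ => false

/-- The value returned by a coin flip step. -/
def Event.coin {Ω L V R W : Type*} : Event Ω L V R W → Option Ω
  | .flip w => some w
  | _ => none

/-- One entry of an execution. -/
structure Record (n : ℕ) (Ω L V R W : Type*) where
  pid : Fin n
  ev : Event Ω L V R W

/-- The situation after a finite execution `hist` (in chronological order). The last three fields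
record, per process, the number of invocations of `elect()`, the number of shared memory steps made
during `elect()`, and the value returned by `elect()` (if it has returned). -/
structure Config (n : ℕ) (Ω L V S Q R W : Type*) where
  mem : L → V
  gmem : R → W
  ctl : Fin n → Ctl L V S Q R W
  hist : List (Record n Ω L V R W)
  calls : Fin n → ℕ
  steps : Fin n → ℕ
  result : Fin n → Option Outcome

section Model

variable {n : ℕ} {Ω L V S Q R W : Type*}

/-- Append a step of `p` to the execution. -/
def Config.log (c : Config n Ω L V S Q R W) (p : Fin n) (e : Event Ω L V R W) :
    Config n Ω L V S Q R W :=
  { c with hist := c.hist ++ [⟨p, e⟩] }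

/-- Set the control state of `p`. -/
def Config.goto (c : Config n Ω L V S Q R W) (p : Fin n) (x : Ctl L V S Q R W) :
    Config n Ω L V S Q R W :=
  { c with ctl := Function.update c.ctl p x }

/-- Count a shared memory step of `p` inside `elect()`, and then continue `elect()` or return. -/
def Config.resume (c : Config n Ω L V S Q R W) (p : Fin n) (cont : Outcome → S) :
    Q ⊕ Outcome → Config n Ω L V S Q R W
  | .inl q =>
    { c.goto p (.meth q cont) with steps := Function.update c.steps p (c.steps p + 1) }
  | .inr o =>
    { c.goto p (.code (cont o)) with
      steps := Function.update c.steps p (c.steps p + 1)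
      result := Function.update c.result p (some o) }

open Classical in
/-- The next step of process `p`; `w` is the value returned if this step is a coin flip. The call
of `elect()` is invoked with its first coin flip. -/
noncomputable def Config.step (I : Impl Ω Q R W) (M : Algo n Ω L V S)
    (c : Config n Ω L V S Q R W) (p : Fin n) (w : Ω) : Config n Ω L V S Q R W :=
  match c.ctl p with
  | .code s =>
    match M.next p s with
    | .halt => c.log p .noop
    | .flip op => (c.goto p (.codeOp (op w))).log p (.flip w)
    | .call cont =>
      { (c.goto p (.methOp (I.act I.start w) cont)).log p (.flip w) with
        calls := Function.update c.calls p (c.calls p + 1) }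
  | .codeOp (.read x cont) =>
    (c.goto p (.code (cont (c.mem x)))).log p (.read (.inl x) (.inl (c.mem x)))
  | .codeOp (.write x v s) =>
    { (c.goto p (.code s)).log p (.write (.inl x) (.inl v)) with
      mem := Function.update c.mem x v }
  | .meth q cont => (c.goto p (.methOp (I.act q w) cont)).log p (.flip w)
  | .methOp (.read x g) cont =>
    (c.resume p cont (g (c.gmem x))).log p (.read (.inr x) (.inr (c.gmem x)))
  | .methOp (.write x v r) cont =>
    { (c.resume p cont r).log p (.write (.inr x) (.inr v)) with
      gmem := Function.update c.gmem x v }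

/-- The number of coin flips made so far, by all processes together. -/
def Config.flips (c : Config n Ω L V S Q R W) : ℕ :=
  (c.hist.filterMap fun r => r.ev.coin).length

/-- The initial configuration (empty execution). -/
def Config.initial (I : Impl Ω Q R W) (M : Algo n Ω L V S) : Config n Ω L V S Q R W where
  mem := M.init
  gmem := I.init
  ctl p := .code (M.start p)
  hist := []
  calls _ := 0
  steps _ := 0
  result _ := none

/-- The finite execution determined by a finite schedule `σ` and a coin flip vector `ω`: the `i`-th
coin flip among all processes returns `ω i`. -/
noncomputable def run (I : Impl Ω Q R W) (M : Algo n Ω L V S) (σ : List (Fin n)) (ω : ℕ → Ω) :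
    Config n Ω L V S Q R W :=
  σ.foldl (fun c p => c.step I M p (ω c.flips)) (Config.initial I M)

/-- An adversary maps finite executions to the process that takes the next step. -/
abbrev Adversary (n : ℕ) (Ω L V R W : Type*) := List (Record n Ω L V R W) → Fin n

/-- The first `t` steps of the execution scheduled by the adversary `A` with coin flip vector
`ω`. -/
noncomputable def advRun (I : Impl Ω Q R W) (M : Algo n Ω L V S) (A : Adversary n Ω L V R W)
    (ω : ℕ → Ω) : ℕ → Config n Ω L V S Q R W
  | 0 => Config.initial I M
  | t + 1 =>
    (advRun I M A ω t).step I M (A (advRun I M A ω t).hist) (ω (advRun I M A ω t).flips)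

/-- Every process calls `elect()` at most once in every execution. -/
def OneTime (I : Impl Ω Q R W) (M : Algo n Ω L V S) : Prop :=
  ∀ (σ : List (Fin n)) (ω : ℕ → Ω) (p : Fin n), (run I M σ ω).calls p ≤ 1

/-- Group election property: in every execution in which some process calls `elect()` and all
calls of `elect()` have returned, some call has returned `win`. -/
def NotAllLose (I : Impl Ω Q R W) (M : Algo n Ω L V S) : Prop :=
  ∀ (σ : List (Fin n)) (ω : ℕ → Ω),
    (∃ p, 1 ≤ (run I M σ ω).calls p) →
    (∀ p, 1 ≤ (run I M σ ω).calls p → (run I M σ ω).result p ≠ none) →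
    ∃ p, (run I M σ ω).result p = some .win

/-- The values of all coin flips of `p` that precede the latest shared memory step of `p`. -/
def visibleFlips (h : List (Record n Ω L V R W)) (p : Fin n) : List Ω :=
  ((h.filter fun r => r.pid = p).reverse.dropWhile fun r => !r.ev.isMem).reverse.filterMap
    fun r => r.ev.coin

/-- The register that `p` accesses in its next step, if that step is a shared memory step. -/
def Config.pendingReg (c : Config n Ω L V S Q R W) (p : Fin n) : Option (L ⊕ R) :=
  match c.ctl p with
  | .codeOp op => some (.inl op.reg)
  | .methOp op _ => some (.inr op.reg)
  | _ => none

/-- The adversary's decision depends only on the past schedule, on the coin flips of each process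
preceding its latest shared memory step, and on the registers that the processes whose next step is
a shared memory step will access. -/
def RWOblivious (I : Impl Ω Q R W) (M : Algo n Ω L V S) (A : Adversary n Ω L V R W) : Prop :=
  ∀ (σ σ' : List (Fin n)) (ω ω' : ℕ → Ω),
    (run I M σ ω).hist.map (·.pid) = (run I M σ' ω').hist.map (·.pid) →
    (∀ p, visibleFlips (run I M σ ω).hist p = visibleFlips (run I M σ' ω').hist p) →
    (∀ p, (run I M σ ω).pendingReg p = (run I M σ' ω').pendingReg p) →
    A (run I M σ ω).hist = A (run I M σ' ω').hist

/-- Process `p` is poised to invoke `elect()`. -/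
def Config.Poised (M : Algo n Ω L V S) (c : Config n Ω L V S Q R W) (p : Fin n) : Prop :=
  ∃ s cont, c.ctl p = .code s ∧ M.next p s = .call cont

/-- The maximum number of processes that invoke `elect()` in an execution extending `E`. -/
noncomputable def maxContention (I : Impl Ω Q R W) (M : Algo n Ω L V S)
    (E : List (Record n Ω L V R W)) : ℕ∞ :=
  ⨆ (σ : List (Fin n)) (ω : ℕ → Ω) (_ : E <+: (run I M σ ω).hist),
    Set.encard {p | 1 ≤ (run I M σ ω).calls p}

/-- The executions that can result for `A`, that end when the first process becomes poised to invoke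
`elect()`, and that have max-contention at most `k`. -/
def Exec (I : Impl Ω Q R W) (M : Algo n Ω L V S) (A : Adversary n Ω L V R W) (k : ℕ) :
    Set (List (Record n Ω L V R W)) :=
  {E | (∃ (ω : ℕ → Ω) (t : ℕ), E = (advRun I M A ω t).hist ∧
      (∃ p, (advRun I M A ω t).Poised M p) ∧
      ∀ s < t, ∀ p, ¬ (advRun I M A ω s).Poised M p) ∧
    maxContention I M E ≤ k}

/-- The event that the random execution scheduled by `A` is an extension of `E`. -/
def extensionEvent (I : Impl Ω Q R W) (M : Algo n Ω L V S) (A : Adversary n Ω L V R W)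
    (E : List (Record n Ω L V R W)) : Set (ℕ → Ω) :=
  {ω | ∃ t, E <+: (advRun I M A ω t).hist}

/-- The number of elected processes in the (infinite) execution scheduled by `A`. -/
noncomputable def winners (I : Impl Ω Q R W) (M : Algo n Ω L V S) (A : Adversary n Ω L V R W)
    (ω : ℕ → Ω) : ℝ≥0∞ :=
  (Set.ncard {p | ∃ t, (advRun I M A ω t).result p = some .win} : ℝ≥0∞)

/-- The maximum over all processes of the number of shared memory steps made during `elect()` in the
(infinite) execution scheduled by `A`. -/
noncomputable def maxSteps (I : Impl Ω Q R W) (M : Algo n Ω L V S) (A : Adversary n Ω L V R W)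
    (ω : ℕ → Ω) : ℝ≥0∞ :=
  ⨆ (p : Fin n) (t : ℕ), ((advRun I M A ω t).steps p : ℝ≥0∞)

/-- The effectiveness of the group election implementation in algorithm `M` against `A`, where coin
flips are independent with distribution `D`. -/
noncomputable def effectiveness [MeasurableSpace Ω] (D : Measure Ω) [IsProbabilityMeasure D]
    (I : Impl Ω Q R W) (M : Algo n Ω L V S) (A : Adversary n Ω L V R W) (k : ℕ) : ℝ≥0∞ :=
  ⨆ E ∈ Exec I M A k,
    ∫⁻ ω, winners I M A ω
      ∂(cond (Measure.infinitePi fun _ : ℕ => D) (extensionEvent I M A E))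

/-- The adaptive expected max-step complexity of `elect()` in algorithm `M` against `A`. -/
noncomputable def expMaxStep [MeasurableSpace Ω] (D : Measure Ω) [IsProbabilityMeasure D]
    (I : Impl Ω Q R W) (M : Algo n Ω L V S) (A : Adversary n Ω L V R W) (k : ℕ) : ℝ≥0∞ :=
  ⨆ E ∈ Exec I M A k,
    ∫⁻ ω, maxSteps I M A ω
      ∂(cond (Measure.infinitePi fun _ : ℕ => D) (extensionEvent I M A E))

end Model

/-! The two-phase sifting algorithm. -/

/-- The registers `Up[i]` and `Down[i]`; they store `0` or `1` (`false` or `true`). -/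
inductive SiftReg
  | up (i : ℕ)
  | down (i : ℕ)

/-- Local states of the sifting algorithm: about to choose `c_i` in the backward sifting phase, or
about to choose `c'_i` in the forward sifting phase. -/
inductive SiftState
  | backward (i : ℕ)
  | forward (i : ℕ)

/-- The test of the loop `while i > 1` of the forward sifting phase. -/
def siftLoop (i : ℕ) : SiftState ⊕ Outcome :=
  if 1 < i then .inl (.forward (i - 1)) else .inr .win

open Classical in
/-- The two-phase sifting algorithm with arrays `Up[1..ℓ]` and `Down[1..ℓ-1]`. The choice in round
`i` is heads if the coin flip lies in `H i`. -/
noncomputable def sift {Ω : Type*} (ℓ : ℕ) (H : ℕ → Set Ω) : Impl Ω SiftState SiftReg Bool where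
  start := .backward 1
  init _ := false
  act
    | .backward i, w =>
      if w ∈ H i then
        .write (.up i) true (if i = ℓ then siftLoop i else .inl (.backward (i + 1)))
      else
        .read (.up i) fun v => if v = true then .inr .lose else siftLoop i
    | .forward i, w =>
      if w ∈ H i then
        .write (.down i) true (siftLoop i)
      else
        .read (.down i) fun v => if v = true then .inr .lose else siftLoop i

/-- The probability of heads in round `i ≥ 1`. -/
noncomputable def headsProb (i : ℕ) : ℝ := 1 / 2 ^ ((3 / 2 : ℝ) ^ (i - 1))

/-- `ℓ = ⌈log_{3/2} log₂ n⌉`. This is at least `2` for `n ≥ 3`; for `n ≤ 2`, where the formula gives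
no nonempty array `Up[1..ℓ]`, we put `ℓ = 1`. -/
noncomputable def arrayLen (n : ℕ) : ℕ := max 1 ⌈Real.logb (3 / 2) (Real.logb 2 n)⌉₊

end GroupElect

namespace GroupElect

open MeasureTheory ProbabilityTheory
open scoped ENNReal

/-! ### Single steps and finite executions -/

section Model

variable {n : ℕ} {Ω L V S Q R W : Type*}

/-! Both expectation bounds come from one potential argument. Give every pending `elect()` call a
value that depends only on the register it accesses next, give every call still to come the value of
a fresh call, give every win a fixed value, and add a function of the registers. An r/w-oblivious
adversary knows the register a process will access but not whether it reads or writes, so when it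
schedules a shared memory step of `elect()`, the coin deciding that step is still independent of
everything the adversary has used. `RWOblivious.advRun_update` makes this precise: changing that
coin changes only the pending operation and its log entry. The coin can therefore be resampled
(`lintegral_le_lintegral_of_update`), and a one-round inequality, averaged over one coin, makes the
expected potential nonincreasing (`RWOblivious.setLIntegral_potential_succ_le`). Conditioning on `E`
does no harm: all processes are outside `elect()` at the end of `E`, so every coin that is resampled
is tossed later. `RWOblivious.lintegral_cond_le` packages the result.

Winners: a call is worth the probability that it only writes until it wins. Processes may also
advance by reading a register that is still `0`; each round pays for this with a deposit on the
register, lost at the first write (`winValue_supermartingale`). For base `3/2` the product of the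
first `i` heads probabilities is `2^(2 - 2 (3/2)^i)`, so the deposit for index `i` is `4 q_i`. The
deposits of the two arrays total at most `14` and the initial calls at most `2`.

Steps: a process can only get to index `j` by writing `Up[1], …, Up[j-1]` itself, so the number of
written `Up` entries controls all step counts (`OneTime.steps_le`). A second potential
(`upWrittenValue_supermartingale`) bounds the probability that `Up[r]` is written by `k` times the
product of the first `r` heads probabilities. This falls below a decaying geometric sequence from `r
= ⌈log_{3/2} log₂ k⌉` on.

Some call wins because of a deterministic invariant (`OneTime.exists_not_lost`): a process that
loses reads a register which a surviving process has already passed. -/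

open Classical in
/-- The result of a shared memory step in memory state `g`, together with the new memory state. -/
noncomputable def Op.apply {X Y T : Type*} (g : X → Y) : Op X Y T → T × (X → Y)
  | .read x k => (k (g x), g)
  | .write x v r => (r, Function.update g x v)

/-- The process is not inside an `elect()` call. -/
def Ctl.Idle (x : Ctl L V S Q R W) : Prop :=
  (∃ s, x = .code s) ∨ ∃ op, x = .codeOp op

/-- The situation after a step of `p`, as far as `elect()` is concerned. -/
theorem Config.step_cases (I : Impl Ω Q R W) (M : Algo n Ω L V S)
    (c : Config n Ω L V S Q R W) (p : Fin n) (w : Ω) :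
    (∀ p', p' ≠ p → (c.step I M p w).ctl p' = c.ctl p') ∧
    (((c.ctl p).Idle ∧ ((c.step I M p w).ctl p).Idle ∧ (c.step I M p w).gmem = c.gmem ∧
        (c.step I M p w).calls = c.calls ∧ (c.step I M p w).steps = c.steps ∧
        (c.step I M p w).result = c.result) ∨
      ((c.ctl p).Idle ∧ c.Poised M p ∧
        (∃ cont, (c.step I M p w).ctl p = .methOp (I.act I.start w) cont) ∧
        (c.step I M p w).gmem = c.gmem ∧
        (c.step I M p w).calls = Function.update c.calls p (c.calls p + 1) ∧
        (c.step I M p w).steps = c.steps ∧ (c.step I M p w).result = c.result) ∨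
      (∃ q cont, c.ctl p = .meth q cont ∧
        (c.step I M p w).ctl p = .methOp (I.act q w) cont ∧
        (c.step I M p w).gmem = c.gmem ∧ (c.step I M p w).calls = c.calls ∧
        (c.step I M p w).steps = c.steps ∧ (c.step I M p w).result = c.result) ∨
      (∃ op cont, c.ctl p = .methOp op cont ∧
        (c.step I M p w).gmem = (op.apply c.gmem).2 ∧ (c.step I M p w).calls = c.calls ∧
        (c.step I M p w).steps = Function.update c.steps p (c.steps p + 1) ∧
        ((∃ q, (op.apply c.gmem).1 = .inl q ∧ (c.step I M p w).ctl p = .meth q cont ∧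
            (c.step I M p w).result = c.result) ∨
          (∃ o, (op.apply c.gmem).1 = .inr o ∧ (c.step I M p w).ctl p = .code (cont o) ∧
            (c.step I M p w).result = Function.update c.result p (some o))))) := by
  simp only [Config.step]
  rcases hc : c.ctl p with s | (⟨x, k⟩ | ⟨x, v, s⟩) | ⟨q, cont⟩ | ⟨(⟨x, k⟩ | ⟨x, v, r⟩), cont⟩
  · rcases hs : M.next p s with _ | op | cont <;> simp only [hs]
    · refine ⟨fun p' hp => rfl, Or.inl ?_⟩
      simp [Config.log, Ctl.Idle, hc]
    · refine ⟨fun p' hp => by simp [Config.log, Config.goto, hp], Or.inl ?_⟩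
      simp [Config.log, Config.goto, Ctl.Idle]
    · refine ⟨fun p' hp => by simp [Config.log, Config.goto, hp], Or.inr (Or.inl ?_)⟩
      refine ⟨Or.inl ⟨_, rfl⟩, ⟨s, cont, hc, hs⟩, ⟨cont, ?_⟩, ?_⟩
      · simp [Config.log, Config.goto]
      · simp [Config.log, Config.goto]
  · refine ⟨fun p' hp => by simp [Config.log, Config.goto, hp], Or.inl ?_⟩
    simp [Config.log, Config.goto, Ctl.Idle]
  · refine ⟨fun p' hp => by simp [Config.log, Config.goto, hp], Or.inl ?_⟩
    simp [Config.log, Config.goto, Ctl.Idle]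
  · refine ⟨fun p' hp => by simp [Config.log, Config.goto, hp], Or.inr (Or.inr (Or.inl ?_))⟩
    exact ⟨q, cont, rfl, by simp [Config.log, Config.goto]⟩
  · rcases hr : k (c.gmem x) with q | o
    · refine ⟨fun p' hp => by simp [Config.resume, Config.log, Config.goto, hr, hp],
        Or.inr (Or.inr (Or.inr ?_))⟩
      exact ⟨_, cont, rfl, by simp [Config.resume, Config.log, Config.goto, Op.apply, hr]⟩
    · refine ⟨fun p' hp => by simp [Config.resume, Config.log, Config.goto, hr, hp],
        Or.inr (Or.inr (Or.inr ?_))⟩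
      exact ⟨_, cont, rfl, by simp [Config.resume, Config.log, Config.goto, Op.apply, hr]⟩
  · rcases r with q | o
    · refine ⟨fun p' hp => by simp [Config.resume, Config.log, Config.goto, hp],
        Or.inr (Or.inr (Or.inr ?_))⟩
      exact ⟨_, cont, rfl, by simp [Config.resume, Config.log, Config.goto, Op.apply]⟩
    · refine ⟨fun p' hp => by simp [Config.resume, Config.log, Config.goto, hp],
        Or.inr (Or.inr (Or.inr ?_))⟩
      exact ⟨_, cont, rfl, by simp [Config.resume, Config.log, Config.goto, Op.apply]⟩

theorem Config.step_ctl_of_ne (I : Impl Ω Q R W) (M : Algo n Ω L V S)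
    (c : Config n Ω L V S Q R W) {p p' : Fin n} (w : Ω) (h : p' ≠ p) :
    (c.step I M p w).ctl p' = c.ctl p' :=
  (c.step_cases I M p w).1 p' h

/-- A step either is a coin flip, which appends its value to the execution, or it does not depend
on the coin. -/
theorem Config.step_coin (I : Impl Ω Q R W) (M : Algo n Ω L V S)
    (c : Config n Ω L V S Q R W) (p : Fin n) :
    (∀ w, (c.step I M p w).hist = c.hist ++ [⟨p, .flip w⟩]) ∨
    (∃ e : Event Ω L V R W, ∀ w, (c.step I M p w).hist = c.hist ++ [⟨p, e⟩]) ∧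
      ∀ w w', c.step I M p w = c.step I M p w' := by
  simp only [Config.step]
  rcases hc : c.ctl p with s | (⟨x, k⟩ | ⟨x, v, s⟩) | ⟨q, cont⟩ | ⟨(⟨x, k⟩ | ⟨x, v, r⟩), cont⟩
  · rcases hs : M.next p s with _ | op | cont <;> simp only [hs]
    · exact Or.inr ⟨⟨.noop, fun w => rfl⟩, fun _ _ => trivial⟩
    · exact Or.inl fun w => rfl
    · exact Or.inl fun w => rfl
  · exact Or.inr ⟨⟨_, fun w => rfl⟩, fun _ _ => rfl⟩
  · exact Or.inr ⟨⟨_, fun w => rfl⟩, fun _ _ => rfl⟩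
  · exact Or.inl fun w => rfl
  · refine Or.inr ⟨⟨.read (.inr x) (.inr (c.gmem x)), fun w => ?_⟩, fun _ _ => rfl⟩
    rcases hr : k (c.gmem x) with q | o <;> simp [Config.resume, Config.log, Config.goto, hr]
  · refine Or.inr ⟨⟨.write (.inr x) (.inr v), fun w => ?_⟩, fun _ _ => rfl⟩
    rcases r with q | o <;> simp [Config.resume, Config.log, Config.goto]

theorem Config.exists_step_hist (I : Impl Ω Q R W) (M : Algo n Ω L V S)
    (c : Config n Ω L V S Q R W) (p : Fin n) (w : Ω) :
    ∃ e : Event Ω L V R W, (c.step I M p w).hist = c.hist ++ [⟨p, e⟩] := by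
  rcases c.step_coin I M p with h | ⟨⟨e, h⟩, _⟩
  exacts [⟨_, h w⟩, ⟨_, h w⟩]

theorem Config.flips_le_flips_step (I : Impl Ω Q R W) (M : Algo n Ω L V S)
    (c : Config n Ω L V S Q R W) (p : Fin n) (w : Ω) :
    c.flips ≤ (c.step I M p w).flips := by
  obtain ⟨e, he⟩ := c.exists_step_hist I M p w
  simp [Config.flips, he]

/-- The only randomness of a step is its coin, and the coin is logged. -/
theorem Config.step_eq_step_of_hist_eq (I : Impl Ω Q R W) (M : Algo n Ω L V S)
    (c : Config n Ω L V S Q R W) (p : Fin n) {w w' : Ω}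
    (h : (c.step I M p w).hist = (c.step I M p w').hist) :
    c.step I M p w = c.step I M p w' := by
  rcases c.step_coin I M p with h' | ⟨_, h'⟩
  · rw [h', h'] at h
    have : w = w' := by simpa using h
    rw [this]
  · exact h' w w'

/-- A coin flip step increases the number of coin flips, any other step is independent of the
coin. -/
theorem Config.flips_step_or (I : Impl Ω Q R W) (M : Algo n Ω L V S)
    (c : Config n Ω L V S Q R W) (p : Fin n) :
    (∀ w, (c.step I M p w).flips = c.flips + 1) ∨
      ∀ w w', c.step I M p w = c.step I M p w' := by
  rcases c.step_coin I M p with h | ⟨_, h⟩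
  · exact Or.inl fun w => by simp [Config.flips, h w, Event.coin]
  · exact Or.inr h

/-- Change the control state of `p` and the recorded execution. -/
def Config.modify (c : Config n Ω L V S Q R W) (p : Fin n) (x : Ctl L V S Q R W)
    (h : List (Record n Ω L V R W)) : Config n Ω L V S Q R W :=
  { c with ctl := Function.update c.ctl p x, hist := h }

/-- A step of `p'` does not depend on the control state of another process. -/
theorem Config.step_modify (I : Impl Ω Q R W) (M : Algo n Ω L V S)
    (c : Config n Ω L V S Q R W) {p p' : Fin n} (hp : p' ≠ p) (x : Ctl L V S Q R W) (w : Ω) :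
    ∃ e : Event Ω L V R W, (c.step I M p' w).hist = c.hist ++ [⟨p', e⟩] ∧
      ∀ h, (c.modify p x h).step I M p' w =
        (c.step I M p' w).modify p x (h ++ [⟨p', e⟩]) := by
  have hx : ∀ h, (c.modify p x h).ctl p' = c.ctl p' := fun h => by simp [Config.modify, hp]
  have hu : ∀ y, Function.update (Function.update c.ctl p x) p' y =
      Function.update (Function.update c.ctl p' y) p x :=
    fun y => Function.update_comm hp.symm _ _ _
  simp only [Config.step, hx]
  rcases hc : c.ctl p' with s | (⟨y, k⟩ | ⟨y, v, s⟩) | ⟨q, cont⟩ | ⟨(⟨y, k⟩ | ⟨y, v, r⟩), cont⟩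
  · rcases hs : M.next p' s with _ | op | cont <;> simp only [hs]
    · exact ⟨.noop, rfl, fun h => rfl⟩
    · exact ⟨.flip w, rfl, fun h => by simp [Config.modify, Config.log, Config.goto, hu]⟩
    · exact ⟨.flip w, rfl, fun h => by simp [Config.modify, Config.log, Config.goto, hu]⟩
  · exact ⟨.read (.inl y) (.inl (c.mem y)), rfl,
      fun h => by simp [Config.modify, Config.log, Config.goto, hu]⟩
  · exact ⟨.write (.inl y) (.inl v), rfl,
      fun h => by simp [Config.modify, Config.log, Config.goto, hu]⟩
  · exact ⟨.flip w, rfl, fun h => by simp [Config.modify, Config.log, Config.goto, hu]⟩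
  · refine ⟨.read (.inr y) (.inr (c.gmem y)), ?_, fun h => ?_⟩ <;>
    rcases hr : k (c.gmem y) with q | o <;>
    simp [Config.modify, Config.resume, Config.log, Config.goto, hu, hr]
  · refine ⟨.write (.inr y) (.inr v), ?_, fun h => ?_⟩ <;>
    rcases r with q | o <;>
    simp [Config.modify, Config.resume, Config.log, Config.goto, hu]

theorem run_append (I : Impl Ω Q R W) (M : Algo n Ω L V S) (σ : List (Fin n)) (p : Fin n)
    (ω : ℕ → Ω) :
    run I M (σ ++ [p]) ω = (run I M σ ω).step I M p (ω (run I M σ ω).flips) := by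
  simp [run]

theorem exists_run_eq_advRun (I : Impl Ω Q R W) (M : Algo n Ω L V S) (A : Adversary n Ω L V R W)
    (ω : ℕ → Ω) (t : ℕ) : ∃ σ, run I M σ ω = advRun I M A ω t := by
  induction t with
  | zero => exact ⟨[], rfl⟩
  | succ t ih =>
    obtain ⟨σ, hσ⟩ := ih
    exact ⟨σ ++ [A (advRun I M A ω t).hist], by rw [run_append, hσ, advRun]⟩

theorem length_hist_advRun (I : Impl Ω Q R W) (M : Algo n Ω L V S) (A : Adversary n Ω L V R W)
    (ω : ℕ → Ω) (t : ℕ) : (advRun I M A ω t).hist.length = t := by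
  induction t with
  | zero => rfl
  | succ t ih =>
    obtain ⟨e, he⟩ := (advRun I M A ω t).exists_step_hist I M (A (advRun I M A ω t).hist)
      (ω (advRun I M A ω t).flips)
    rw [advRun, he]
    simp [ih]

theorem hist_advRun_prefix (I : Impl Ω Q R W) (M : Algo n Ω L V S) (A : Adversary n Ω L V R W)
    (ω : ℕ → Ω) {s t : ℕ} (h : s ≤ t) :
    (advRun I M A ω s).hist <+: (advRun I M A ω t).hist := by
  induction t, h using Nat.le_induction with
  | base => exact List.prefix_rfl
  | succ t _ ih =>
    obtain ⟨e, he⟩ := (advRun I M A ω t).exists_step_hist I M (A (advRun I M A ω t).hist)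
      (ω (advRun I M A ω t).flips)
    rw [advRun, he]
    exact ih.trans (List.prefix_append _ _)

theorem flips_advRun_mono (I : Impl Ω Q R W) (M : Algo n Ω L V S) (A : Adversary n Ω L V R W)
    (ω : ℕ → Ω) : Monotone fun t => (advRun I M A ω t).flips :=
  monotone_nat_of_le_succ fun _ => Config.flips_le_flips_step ..

theorem flips_advRun_le (I : Impl Ω Q R W) (M : Algo n Ω L V S) (A : Adversary n Ω L V R W)
    (ω : ℕ → Ω) (t : ℕ) : (advRun I M A ω t).flips ≤ t := by
  conv_rhs => rw [← length_hist_advRun I M A ω t]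
  exact List.length_filterMap_le _ _

/-- After `t` steps the history has length exactly `t`, so whether `E` is extended is decided at
time `E.length`. This turns the conditioning event into one about finitely many coins. -/
theorem prefix_hist_advRun_iff (I : Impl Ω Q R W) (M : Algo n Ω L V S)
    (A : Adversary n Ω L V R W) (ω : ℕ → Ω) (E : List (Record n Ω L V R W)) :
    (∃ t, E <+: (advRun I M A ω t).hist) ↔ (advRun I M A ω E.length).hist = E := by
  refine ⟨fun ⟨t, ht⟩ => ?_, fun h => ⟨E.length, by rw [h]⟩⟩
  have hle : E.length ≤ t := by
    simpa [length_hist_advRun] using ht.length_le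
  have := List.prefix_of_prefix_length_le ht (hist_advRun_prefix I M A ω hle)
    (by rw [length_hist_advRun])
  exact (this.eq_of_length (by rw [length_hist_advRun])).symm

/-- The execution determines the configuration. -/
theorem advRun_eq_of_hist_eq (I : Impl Ω Q R W) (M : Algo n Ω L V S)
    (A : Adversary n Ω L V R W) {ω ω' : ℕ → Ω} {t : ℕ}
    (h : (advRun I M A ω t).hist = (advRun I M A ω' t).hist) :
    advRun I M A ω t = advRun I M A ω' t := by
  induction t with
  | zero => rfl
  | succ t ih =>
    have hh : (advRun I M A ω t).hist = (advRun I M A ω' t).hist := by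
      have h1 := hist_advRun_prefix I M A ω t.le_succ
      have h2 := hist_advRun_prefix I M A ω' t.le_succ
      rw [← h] at h2
      exact (List.prefix_of_prefix_length_le h1 h2 (by simp [length_hist_advRun])).eq_of_length
        (by simp [length_hist_advRun])
    have hc := ih hh
    rw [advRun, advRun, hc] at h ⊢
    exact Config.step_eq_step_of_hist_eq _ _ _ _ h

/-- The number of coin flips made (by all processes) before the latest step of `p`. If that step
is a coin flip then this is its index in the coin flip vector. -/
noncomputable def lastFlip (I : Impl Ω Q R W) (M : Algo n Ω L V S) (A : Adversary n Ω L V R W)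
    (ω : ℕ → Ω) : ℕ → Fin n → ℕ
  | 0 => fun _ => 0
  | t + 1 => Function.update (lastFlip I M A ω t) (A (advRun I M A ω t).hist)
      (advRun I M A ω t).flips

/-- An execution depends only on the coin flips made in it. -/
theorem advRun_congr (I : Impl Ω Q R W) (M : Algo n Ω L V S) (A : Adversary n Ω L V R W)
    {ω ω' : ℕ → Ω} {t : ℕ} (h : ∀ i < (advRun I M A ω t).flips, ω i = ω' i) :
    advRun I M A ω t = advRun I M A ω' t ∧ lastFlip I M A ω t = lastFlip I M A ω' t := by
  induction t with
  | zero => exact ⟨rfl, rfl⟩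
  | succ t ih =>
    obtain ⟨h1, h2⟩ := ih fun i hi =>
      h i (hi.trans_le (flips_advRun_mono I M A ω t.le_succ))
    refine ⟨?_, by rw [lastFlip, lastFlip, h1, h2]⟩
    rw [advRun, advRun, ← h1]
    rcases (advRun I M A ω t).flips_step_or I M (A (advRun I M A ω t).hist) with h' | h'
    · rw [h _ (by rw [advRun, h']; exact Nat.lt_succ_self _)]
    · exact h' _ _

/-- The part of the configuration of `p` that concerns its `elect()` call is consistent. -/
def Config.LocalInv (I : Impl Ω Q R W) (c : Config n Ω L V S Q R W) (p : Fin n) : Prop :=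
  ((c.ctl p).Idle ∧ (c.calls p = 0 ∧ c.steps p = 0 ∧ c.result p = none ∨
      c.calls p = 1 ∧ c.result p ≠ none)) ∨
  c.calls p = 1 ∧ c.result p = none ∧ ((∃ q cont, c.ctl p = .meth q cont) ∨
    ∃ q w cont, c.ctl p = .methOp (I.act q w) cont)

/-- One-timeness is needed only where `p` invokes `elect()`: the bound on calls after that step
forces the count before it to be `0`, so the call starts with no steps and no result. -/
theorem OneTime.localInv {I : Impl Ω Q R W} {M : Algo n Ω L V S} (hM : OneTime I M)
    (σ : List (Fin n)) (ω : ℕ → Ω) (p : Fin n) : (run I M σ ω).LocalInv I p := by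
  induction σ using List.reverseRecOn with
  | nil => exact Or.inl ⟨Or.inl ⟨_, rfl⟩, Or.inl ⟨rfl, rfl, rfl⟩⟩
  | append_singleton σ p' ih =>
    have h1 := hM (σ ++ [p']) ω p
    rw [run_append] at h1 ⊢
    generalize run I M σ ω = c at *
    generalize ω c.flips = w at *
    obtain ⟨hne, hc⟩ := c.step_cases I M p' w
    unfold Config.LocalInv at *
    by_cases hp : p = p'
    · subst hp
      rcases hc with ⟨a1, a2, a3, a4, a5, a6⟩ | ⟨a1, a2, a3, a4, a5, a6, a7⟩ |
        ⟨q, cont, a1, a2, a3, a4, a5, a6⟩ | ⟨op, cont, a1, a2, a3, a4, a5⟩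
      · rw [a4, a5, a6]
        rcases ih with ⟨-, ih⟩ | ⟨-, -, ⟨q, cont, ih⟩ | ⟨q, w, cont, ih⟩⟩
        · exact Or.inl ⟨a2, ih⟩
        all_goals simp [Ctl.Idle, ih] at a1
      · rw [a5, Function.update_self] at h1
        have h0 : c.calls p = 0 := by omega
        obtain ⟨cont, a3⟩ := a3
        refine Or.inr ⟨by simp [a5, h0], ?_, Or.inr ⟨_, _, _, a3⟩⟩
        rw [a7]
        rcases ih with ⟨-, ⟨-, -, ih⟩ | ih⟩ | ih
        · exact ih
        · omega
        · omega
      · rw [a4, a6]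
        rcases ih with ⟨ih, -⟩ | ih
        · simp [Ctl.Idle, a1] at ih
        · exact Or.inr ⟨ih.1, ih.2.1, Or.inr ⟨_, _, _, a2⟩⟩
      · rcases ih with ⟨ih, -⟩ | ih
        · simp [Ctl.Idle, a1] at ih
        rw [a3]
        rcases a5 with ⟨q, -, b1, b2⟩ | ⟨o, -, b1, b2⟩
        · exact Or.inr ⟨ih.1, by rw [b2]; exact ih.2.1, Or.inl ⟨_, _, b1⟩⟩
        · exact Or.inl ⟨Or.inl ⟨_, b1⟩, Or.inr ⟨ih.1, by simp [b2]⟩⟩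
    · rw [hne p hp]
      have e1 : (c.step I M p' w).calls p = c.calls p ∧ (c.step I M p' w).steps p = c.steps p ∧
          (c.step I M p' w).result p = c.result p := by
        rcases hc with ⟨a1, a2, a3, a4, a5, a6⟩ | ⟨a1, a2, a3, a4, a5, a6, a7⟩ |
          ⟨q, cont, a1, a2, a3, a4, a5, a6⟩ | ⟨op, cont, a1, a2, a3, a4, a5⟩
        · simp [a4, a5, a6]
        · simp [a5, a6, a7, hp]
        · simp [a4, a5, a6]
        · rcases a5 with ⟨q, -, b1, b2⟩ | ⟨o, -, b1, b2⟩ <;> simp [a3, a4, b2, hp]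
      rw [e1.1, e1.2.1, e1.2.2]
      exact ih

theorem OneTime.localInv_advRun {I : Impl Ω Q R W} {M : Algo n Ω L V S} (hM : OneTime I M)
    (A : Adversary n Ω L V R W) (ω : ℕ → Ω) (t : ℕ) (p : Fin n) :
    (advRun I M A ω t).LocalInv I p := by
  obtain ⟨σ, hσ⟩ := exists_run_eq_advRun I M A ω t
  exact hσ ▸ hM.localInv σ ω p

/-- The value returned by `elect()` never changes. -/
theorem OneTime.result_step {I : Impl Ω Q R W} {M : Algo n Ω L V S} (hM : OneTime I M)
    (σ : List (Fin n)) (ω : ℕ → Ω) (p p' : Fin n) (w : Ω) {o : Outcome}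
    (h : (run I M σ ω).result p = some o) :
    ((run I M σ ω).step I M p' w).result p = some o := by
  have ih := hM.localInv σ ω p
  generalize run I M σ ω = c at *
  obtain ⟨hne, hc⟩ := c.step_cases I M p' w
  rcases hc with ⟨a1, a2, a3, a4, a5, a6⟩ | ⟨a1, a2, a3, a4, a5, a6, a7⟩ |
    ⟨q, cont, a1, a2, a3, a4, a5, a6⟩ | ⟨op, cont, a1, a2, a3, a4, a5⟩
  · rwa [a6]
  · rwa [a7]
  · rwa [a6]
  · rcases a5 with ⟨q, -, b1, b2⟩ | ⟨o', -, b1, b2⟩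
    · rwa [b2]
    · by_cases hp : p = p'
      · subst hp
        rcases ih with ⟨ih, -⟩ | ⟨-, ih, -⟩
        · simp [Ctl.Idle, a1] at ih
        · simp [ih] at h
      · rwa [b2, Function.update_of_ne hp]

theorem OneTime.result_advRun_mono {I : Impl Ω Q R W} {M : Algo n Ω L V S} (hM : OneTime I M)
    (A : Adversary n Ω L V R W) (ω : ℕ → Ω) {s t : ℕ} (hst : s ≤ t) {p : Fin n} {o : Outcome}
    (h : (advRun I M A ω s).result p = some o) : (advRun I M A ω t).result p = some o := by
  induction t, hst using Nat.le_induction with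
  | base => exact h
  | succ t _ ih =>
    obtain ⟨σ, hσ⟩ := exists_run_eq_advRun I M A ω t
    rw [← hσ] at ih
    rw [advRun, ← hσ]
    exact hM.result_step σ ω _ _ _ ih

end Model

/-! ### The adversary cannot see the coin of a pending shared memory step -/

section Model

variable {n : ℕ} {Ω L V S Q R W : Type*}

/-- The effect of a coin flip inside `elect()`. -/
theorem Config.step_of_methOp (I : Impl Ω Q R W) (M : Algo n Ω L V S)
    (c : Config n Ω L V S Q R W) (p : Fin n) (w : Ω) {op : Op R W (Q ⊕ Outcome)}
    {cont : Outcome → S} (h : (c.step I M p w).ctl p = .methOp op cont) :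
    ∃ q, op = I.act q w ∧ ∀ w', (c.step I M p w').flips = c.flips + 1 ∧
      c.step I M p w' = (c.step I M p w).modify p (.methOp (I.act q w') cont)
        (c.hist ++ [⟨p, .flip w'⟩]) := by
  simp only [Config.step] at h ⊢
  rcases hc : c.ctl p with s | (⟨x, k⟩ | ⟨x, v, s⟩) | ⟨q, cont'⟩ | ⟨(⟨x, k⟩ | ⟨x, v, r⟩), cont'⟩ <;>
    simp only [hc] at h
  · rcases hs : M.next p s with _ | op | cont' <;> simp only [hs] at h
    · simp [Config.log, hc] at h
    · simp [Config.log, Config.goto] at h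
    · simp only [Config.log, Config.goto, Function.update_self, Ctl.methOp.injEq] at h
      obtain ⟨rfl, rfl⟩ := h
      exact ⟨I.start, rfl, fun w' => by
        simp only [hs]
        simp [Config.flips, Config.modify, Config.log, Config.goto, Event.coin]⟩
  · simp [Config.log, Config.goto] at h
  · simp [Config.log, Config.goto] at h
  · simp only [Config.log, Config.goto, Function.update_self, Ctl.methOp.injEq] at h
    obtain ⟨rfl, rfl⟩ := h
    exact ⟨q, rfl, fun w' => by
      simp [Config.flips, Config.modify, Config.log, Config.goto, Event.coin]⟩
  · rcases hr : k (c.gmem x) with q | o <;>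
      simp [Config.resume, Config.log, Config.goto, hr] at h
  · rcases r with q | o <;> simp [Config.resume, Config.log, Config.goto] at h

/-- The value of the latest coin flip of a process is not visible. -/
theorem visibleFlips_flip (h₀ h₁ : List (Record n Ω L V R W)) (p p' : Fin n) (w w' : Ω)
    (h : ∀ r ∈ h₁, r.pid ≠ p) :
    visibleFlips (h₀ ++ ⟨p, .flip w⟩ :: h₁) p' = visibleFlips (h₀ ++ ⟨p, .flip w'⟩ :: h₁) p' := by
  by_cases hp : p = p'
  · subst hp
    have : h₁.filter (fun r => decide (r.pid = p)) = [] := by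
      simpa [List.filter_eq_nil_iff] using h
    simp [visibleFlips, this, Event.isMem]
  · simp [visibleFlips, hp]

/-- The adversary's decision does not depend on the value of a coin flip made inside `elect()`
before the shared memory step that follows it. -/
theorem RWOblivious.adversary_congr {I : Impl Ω Q R W} {M : Algo n Ω L V S}
    {A : Adversary n Ω L V R W} (hA : RWOblivious I M A)
    (hI : ∀ q w w', (I.act q w).reg = (I.act q w').reg) {t : ℕ} {ω ω' : ℕ → Ω} {p : Fin n}
    {q : Q} {w w' : Ω} {cont : Outcome → S} {h₀ h₁ : List (Record n Ω L V R W)}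
    (hctl : (advRun I M A ω t).ctl p = .methOp (I.act q w) cont)
    (hhist : (advRun I M A ω t).hist = h₀ ++ ⟨p, .flip w⟩ :: h₁) (hne : ∀ r ∈ h₁, r.pid ≠ p)
    (hω' : advRun I M A ω' t =
      (advRun I M A ω t).modify p (.methOp (I.act q w') cont) (h₀ ++ ⟨p, .flip w'⟩ :: h₁)) :
    A (advRun I M A ω' t).hist = A (advRun I M A ω t).hist := by
  obtain ⟨σ, hσ⟩ := exists_run_eq_advRun I M A ω t
  obtain ⟨σ', hσ'⟩ := exists_run_eq_advRun I M A ω' t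
  have := hA σ' σ ω' ω
  rw [hσ, hσ'] at this
  apply this
  · rw [hω', hhist]
    simp [Config.modify]
  · intro p'
    rw [hω', hhist]
    exact visibleFlips_flip _ _ _ _ _ _ hne
  · intro p'
    rw [hω']
    by_cases hp' : p' = p
    · subst hp'
      simp only [Config.pendingReg, Config.modify, hctl, Function.update_self]
      rw [hI q w' w]
    · simp [Config.pendingReg, Config.modify, hp']

/-- The value of a coin flip made inside `elect()` affects nothing but the shared memory step that
follows it. -/
theorem RWOblivious.advRun_update {I : Impl Ω Q R W} {M : Algo n Ω L V S}
    {A : Adversary n Ω L V R W} (hA : RWOblivious I M A)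
    (hI : ∀ q w w', (I.act q w).reg = (I.act q w').reg) (t : ℕ) :
    ∀ (ω : ℕ → Ω) (p : Fin n) (op : Op R W (Q ⊕ Outcome)) (cont : Outcome → S),
      (advRun I M A ω t).ctl p = .methOp op cont →
      lastFlip I M A ω t p < (advRun I M A ω t).flips ∧
      ∃ q h₀ h₁, op = I.act q (ω (lastFlip I M A ω t p)) ∧
        (advRun I M A ω t).hist = h₀ ++ ⟨p, .flip (ω (lastFlip I M A ω t p))⟩ :: h₁ ∧
        (∀ r ∈ h₁, r.pid ≠ p) ∧
        ∀ w, advRun I M A (Function.update ω (lastFlip I M A ω t p) w) t =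
            (advRun I M A ω t).modify p (.methOp (I.act q w) cont) (h₀ ++ ⟨p, .flip w⟩ :: h₁) ∧
          lastFlip I M A (Function.update ω (lastFlip I M A ω t p) w) t =
            lastFlip I M A ω t := by
  induction t with
  | zero => intro ω p op cont h; simp [advRun, Config.initial] at h
  | succ t ih =>
    intro ω p op cont h
    set c := advRun I M A ω t with hc
    have hstep : advRun I M A ω (t + 1) = c.step I M (A c.hist) (ω c.flips) := rfl
    have hlast : lastFlip I M A ω (t + 1) =
      Function.update (lastFlip I M A ω t) (A c.hist) c.flips := rfl
    -- If `p` itself moved, this step was the coin flip and nothing follows it in the history.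
    -- Otherwise the flip is older, and the step of another process commutes with changing the
    -- pending operation of `p`.
    by_cases hp : p = A c.hist
    · have hm : lastFlip I M A ω (t + 1) p = c.flips := by rw [hlast, hp, Function.update_self]
      rw [hm]
      rw [hstep, ← hp] at h
      obtain ⟨q, hop, hw⟩ := c.step_of_methOp I M p _ h
      rw [hstep, ← hp]
      refine ⟨by rw [(hw _).1]; exact Nat.lt_succ_self _, q, c.hist, [], hop, ?_, by simp,
        fun w => ?_⟩
      · rw [(hw _).2]
        rfl
      · obtain ⟨e1, e2⟩ := advRun_congr I M A (ω := ω) (ω' := Function.update ω c.flips w) (t := t)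
          fun i hi => (Function.update_of_ne hi.ne _ _).symm
        constructor
        · rw [advRun, ← e1, ← hc, Function.update_self, ← hp, (hw w).2]
        · rw [lastFlip, ← e1, ← e2, ← hc, hlast]
    · have hm : lastFlip I M A ω (t + 1) p = lastFlip I M A ω t p := by
        rw [hlast, Function.update_of_ne hp]
      rw [hm]
      rw [hstep, Config.step_ctl_of_ne I M c _ hp] at h
      obtain ⟨hlt, q, h₀, h₁, hop, hh, hne, hw⟩ := ih ω p op cont h
      refine ⟨hlt.trans_le (flips_advRun_mono I M A ω t.le_succ), q, h₀, ?_⟩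
      obtain ⟨e, he, hmod⟩ := c.step_modify I M (p := p) (p' := A c.hist) (Ne.symm hp)
        (.methOp op cont) (ω c.flips)
      refine ⟨h₁ ++ [⟨A c.hist, e⟩], hop, ?_, ?_, fun w => ?_⟩
      · rw [hstep, he, ← hc] at *
        simp [hh]
      · intro r hr
        rcases List.mem_append.1 hr with hr | hr
        · exact hne r hr
        · rw [List.mem_singleton] at hr
          rw [hr]
          exact Ne.symm hp
      · obtain ⟨e1, e2⟩ := hw w
        set ω' := Function.update ω (lastFlip I M A ω t p) w with hω'
        rw [← hc] at e1 hh
        have hflips : (advRun I M A ω' t).flips = c.flips := by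
          rw [e1]
          simp [Config.flips, Config.modify, hh, Event.coin]
        -- Obliviousness enters here: both executions schedule the same process next.
        have hAeq : A (advRun I M A ω' t).hist = A c.hist :=
          hA.adversary_congr hI (hop ▸ h) hh hne e1
        -- The changed coin has already been used, so the next coin is the old one.
        have hcoin : ω' c.flips = ω c.flips := Function.update_of_ne hlt.ne' _ _
        constructor
        · obtain ⟨e', he', hmod'⟩ := c.step_modify I M (p := p) (p' := A c.hist) (Ne.symm hp)
            (.methOp (I.act q w) cont) (ω c.flips)
          have : e' = e := by
            rw [he] at he'
            simpa using he'.symm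
          subst this
          rw [advRun, hAeq, hflips, hcoin, e1, hmod', hstep]
          simp
        · rw [lastFlip, hAeq, hflips, e2, hlast]

/-- A process that is inside its `elect()` call, and was not at time `s`, has made a step since. -/
theorem flips_le_lastFlip (I : Impl Ω Q R W) (M : Algo n Ω L V S) (A : Adversary n Ω L V R W)
    (ω : ℕ → Ω) {s t : ℕ} (hst : s ≤ t) {p : Fin n} (hs : ((advRun I M A ω s).ctl p).Idle)
    (ht : ¬ ((advRun I M A ω t).ctl p).Idle) :
    (advRun I M A ω s).flips ≤ lastFlip I M A ω t p := by
  induction t, hst using Nat.le_induction with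
  | base => exact absurd hs ht
  | succ t hst ih =>
    rw [lastFlip]
    by_cases hp : p = A (advRun I M A ω t).hist
    · rw [← hp, Function.update_self]
      exact flips_advRun_mono I M A ω hst
    · rw [Function.update_of_ne hp]
      rw [advRun, Config.step_ctl_of_ne I M _ _ hp] at ht
      exact ih ht

end Model

/-! ### Resampling a single coin -/

section Resampling

variable {Ω : Type*} [MeasurableSpace Ω]

/-- A function of finitely many coin flips is measurable. -/
theorem measurable_of_congr [Countable Ω] [DiscreteMeasurableSpace Ω] {β : Type*}
    [MeasurableSpace β] (t : ℕ) {g : (ℕ → Ω) → β}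
    (h : ∀ ω ω', (∀ i < t, ω i = ω' i) → g ω = g ω') : Measurable g := by
  rcases isEmpty_or_nonempty Ω with hΩ | ⟨⟨w₀⟩⟩
  · have : IsEmpty (ℕ → Ω) := ⟨fun ω => hΩ.false (ω 0)⟩
    exact measurable_of_empty g
  · let g' : (Fin t → Ω) → β := fun v => g fun i => if hi : i < t then v ⟨i, hi⟩ else w₀
    have hg : g = g' ∘ fun ω i => ω i := by
      funext ω
      exact h _ _ fun i hi => by simp [hi]
    rw [hg]
    exact (Measurable.of_discrete (f := g')).comp
      (measurable_pi_lambda _ fun i => measurable_pi_apply _)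

/-- Replacing one of infinitely many independent coin flips by another independent one does not
change their joint distribution. -/
theorem map_update_infinitePi {ι : Type*} [DecidableEq ι] (D : Measure Ω) [IsProbabilityMeasure D]
    (m : ι) :
    ((Measure.infinitePi fun _ : ι => D).prod D).map
      (fun x : (ι → Ω) × Ω => Function.update x.1 m x.2) = Measure.infinitePi fun _ : ι => D := by
  refine Measure.eq_infinitePi _ fun s u hu => ?_
  rw [Measure.map_apply measurable_update' (MeasurableSet.pi s.countable_toSet fun i _ => hu i)]
  by_cases hm : m ∈ s
  · have : (fun x : (ι → Ω) × Ω => Function.update x.1 m x.2) ⁻¹' (Set.pi s u) =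
        (Set.pi (s.erase m : Finset ι) u) ×ˢ u m := by
      ext ⟨ω, w⟩
      simp only [Set.mem_preimage, Set.mem_pi, Finset.mem_coe, Set.mem_prod, Finset.mem_erase]
      constructor
      · intro h
        refine ⟨fun i hi => ?_, ?_⟩
        · simpa [Function.update_of_ne hi.1] using h i hi.2
        · simpa using h m hm
      · rintro ⟨h1, h2⟩ i hi
        by_cases him : i = m
        · subst him
          simpa using h2
        · rw [Function.update_of_ne him]
          exact h1 i ⟨him, hi⟩
    rw [this, Measure.prod_prod, Measure.infinitePi_pi _ fun i _ => hu i,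
      Finset.prod_erase_mul _ _ hm]
  · have : (fun x : (ι → Ω) × Ω => Function.update x.1 m x.2) ⁻¹' (Set.pi s u) =
        (Set.pi s u) ×ˢ Set.univ := by
      ext ⟨ω, w⟩
      simp only [Set.mem_preimage, Set.mem_pi, Finset.mem_coe, Set.mem_prod, Set.mem_univ, and_true]
      refine forall₂_congr fun i hi => ?_
      rw [Function.update_of_ne (ne_of_mem_of_not_mem hi hm)]
    rw [this, Measure.prod_prod, Measure.infinitePi_pi _ fun i _ => hu i, measure_univ, mul_one]

theorem lintegral_update_infinitePi {ι : Type*} [DecidableEq ι] (D : Measure Ω)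
    [IsProbabilityMeasure D] (m : ι) {f : (ι → Ω) → ℝ≥0∞} (hf : Measurable f) :
    ∫⁻ ω, f ω ∂(Measure.infinitePi fun _ : ι => D) =
      ∫⁻ ω, ∫⁻ w, f (Function.update ω m w) ∂D ∂(Measure.infinitePi fun _ : ι => D) := by
  conv_lhs => rw [← map_update_infinitePi D m]
  rw [lintegral_map hf measurable_update', lintegral_prod]
  exact (hf.comp measurable_update').aemeasurable

/-- Comparison of expectations by averaging over a single coin flip, whose index may depend on the
other ones. -/
theorem lintegral_le_lintegral_of_update {ι : Type*} [DecidableEq ι] [Countable ι] (D : Measure Ω)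
    [IsProbabilityMeasure D] {Y Z : (ι → Ω) → ℝ≥0∞} (hY : Measurable Y)
    (idx : (ι → Ω) → Option ι) (hidx : ∀ o, MeasurableSet {ω | idx ω = o})
    (hnone : ∀ ω, idx ω = none → Y ω ≤ Z ω)
    (hinv : ∀ ω m, idx ω = some m → ∀ w, idx (Function.update ω m w) = some m)
    (hsome : ∀ ω m, idx ω = some m → ∫⁻ w, Y (Function.update ω m w) ∂D ≤ Z ω) :
    ∫⁻ ω, Y ω ∂(Measure.infinitePi fun _ : ι => D) ≤
      ∫⁻ ω, Z ω ∂(Measure.infinitePi fun _ : ι => D) := by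
  have hU : (⋃ o, {ω | idx ω = o}) = Set.univ := by ext; simp
  have hdisj : Pairwise (Function.onFun Disjoint fun o => {ω | idx ω = o}) := by
    intro o o' hne
    refine Set.disjoint_left.2 fun ω h h' => hne ?_
    exact h.symm.trans h'
  rw [← setLIntegral_univ, ← hU, lintegral_iUnion hidx hdisj, ← setLIntegral_univ Z, ← hU,
    lintegral_iUnion hidx hdisj]
  refine ENNReal.tsum_le_tsum fun o => ?_
  rcases o with _ | m
  · exact setLIntegral_mono_ae' (hidx none) (Filter.Eventually.of_forall hnone)
  -- The piece `idx = some m` is invariant under changes of coordinate `m`, so that coordinate can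
  -- be integrated out first. On the complement, `hinv` applied to the inverse update shows that
  -- resampling never leads into the piece.
  · rw [← lintegral_indicator (hidx _), ← lintegral_indicator (hidx _),
      lintegral_update_infinitePi D m (hY.indicator (hidx _))]
    refine lintegral_mono fun ω => ?_
    by_cases hω : idx ω = some m
    · rw [Set.indicator_of_mem (show ω ∈ {ω | idx ω = some m} from hω)]
      refine le_trans (lintegral_mono fun w => ?_) (hsome ω m hω)
      exact Set.indicator_le_self _ _ _
    · have : ∀ w, Function.update ω m w ∉ {ω | idx ω = some m} := by
        intro w hw
        apply hω
        simpa using hinv _ m hw (ω m)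
      simp [Set.indicator_of_notMem (this _)]

end Resampling

/-! ### The potential and its monotonicity in expectation -/

section Potential

variable {n : ℕ} {Ω L V S Q R W : Type*}

/-- The value `ρ` of a call of `elect()` that has returned `win`. -/
def resultValue (ρ : ℝ≥0∞) : Option Outcome → ℝ≥0∞
  | some .win => ρ
  | _ => 0

/-- The value of an `elect()` call after a shared memory step, where a call whose next shared memory
step is on `x` has value `f x`. -/
def contValue (reg : Q → R) (f : R → ℝ≥0∞) (ρ : ℝ≥0∞) : Q ⊕ Outcome → ℝ≥0∞
  | .inl q => f (reg q)
  | .inr o => resultValue ρ (some o)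

/-- The value of a pending `elect()` call. It does not depend on whether the next shared memory
step is a read or a write. -/
def Ctl.value (reg : Q → R) (f : R → ℝ≥0∞) : Ctl L V S Q R W → ℝ≥0∞
  | .meth q _ => f (reg q)
  | .methOp op _ => f op.reg
  | _ => 0

/-- The contribution of everything but the registers and the call of `p` to the potential. -/
noncomputable def Config.potentialBase (I : Impl Ω Q R W) (reg : Q → R) (f : R → ℝ≥0∞) (ρ : ℝ≥0∞)
    (k : ℕ) (c : Config n Ω L V S Q R W) (p : Fin n) : ℝ≥0∞ :=
  ((k - ∑ p', c.calls p' : ℕ) : ℝ≥0∞) * f (reg I.start) +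
    ∑ p' ∈ Finset.univ.erase p, (c.ctl p').value reg f + ∑ p', resultValue ρ (c.result p')

/-- The potential of a configuration, if at most `k` processes call `elect()`. -/
noncomputable def Config.potential (I : Impl Ω Q R W) (reg : Q → R) (f : R → ℝ≥0∞) (ρ : ℝ≥0∞)
    (γ : (R → W) → ℝ≥0∞) (k : ℕ) (c : Config n Ω L V S Q R W) : ℝ≥0∞ :=
  ((k - ∑ p, c.calls p : ℕ) : ℝ≥0∞) * f (reg I.start) +
    ∑ p, (c.ctl p).value reg f + ∑ p, resultValue ρ (c.result p) + γ c.gmem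

variable {I : Impl Ω Q R W} {M : Algo n Ω L V S} {reg : Q → R} {f : R → ℝ≥0∞} {ρ : ℝ≥0∞}
  {γ : (R → W) → ℝ≥0∞} {k : ℕ}

/-- Separates the part that a pending operation of `p` does not influence from the two terms
compared in the one-round inequality. -/
theorem Config.potential_eq (c : Config n Ω L V S Q R W) (p : Fin n) :
    c.potential I reg f ρ γ k =
      c.potentialBase I reg f ρ k p + ((c.ctl p).value reg f + γ c.gmem) := by
  rw [Config.potential, Config.potentialBase,
    ← Finset.add_sum_erase _ (fun p => (c.ctl p).value reg f) (Finset.mem_univ p)]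
  ring

theorem Ctl.Idle.value_eq {x : Ctl L V S Q R W} (h : x.Idle) : x.value reg f = 0 := by
  rcases h with ⟨s, rfl⟩ | ⟨op, rfl⟩ <;> rfl

/-- The potential only changes by the shared memory steps of `elect()`. -/
theorem Config.potential_step_eq (hreg : ∀ q w, (I.act q w).reg = reg q)
    (c : Config n Ω L V S Q R W) (p : Fin n) (w : Ω)
    (hk : ∑ p', (c.step I M p w).calls p' ≤ k) (hp : ∀ op cont, c.ctl p ≠ .methOp op cont) :
    (c.step I M p w).potential I reg f ρ γ k = c.potential I reg f ρ γ k := by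
  obtain ⟨hne, hc⟩ := c.step_cases I M p w
  have hsum : ∑ p' ∈ Finset.univ.erase p, ((c.step I M p w).ctl p').value reg f =
      ∑ p' ∈ Finset.univ.erase p, (c.ctl p').value reg f :=
    Finset.sum_congr rfl fun p' hp' => by rw [hne p' (Finset.ne_of_mem_erase hp')]
  rw [Config.potential_eq _ p, Config.potential_eq _ p, Config.potentialBase,
    Config.potentialBase, hsum]
  rcases hc with ⟨a1, a2, a3, a4, a5, a6⟩ | ⟨a1, a2, ⟨cont, a3⟩, a4, a5, a6, a7⟩ |
    ⟨q, cont, a1, a2, a3, a4, a5, a6⟩ | ⟨op, cont, a1, a2, a3, a4, a5⟩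
  · rw [a1.value_eq, a2.value_eq, a3, a4, a6]
  · have hs : ∑ p', (c.step I M p w).calls p' = ∑ p', c.calls p' + 1 := by
      rw [a5, Finset.sum_update_of_mem (Finset.mem_univ p),
        ← Finset.add_sum_erase _ c.calls (Finset.mem_univ p), Finset.sdiff_singleton_eq_erase]
      ring
    -- By `hk` the subtraction is not truncated: a new call converts one reserved unit `f (reg
    -- I.start)` into the value of the pending operation.
    have : k - ∑ p', c.calls p' = (k - ∑ p', (c.step I M p w).calls p') + 1 := by omega
    rw [a1.value_eq, this, a3, a4, a7]
    simp only [Ctl.value, hreg]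
    push_cast
    ring
  · rw [a1, a2, a3, a4, a6]
    simp only [Ctl.value, hreg]
  · exact absurd a1 (hp _ _)

/-- The potential after a shared memory step of `elect()`. -/
theorem Config.potential_step_le (c : Config n Ω L V S Q R W) (p : Fin n) (w : Ω)
    {op : Op R W (Q ⊕ Outcome)} {cont : Outcome → S} (hp : c.ctl p = .methOp op cont) :
    (c.step I M p w).potential I reg f ρ γ k ≤
      c.potentialBase I reg f ρ k p +
        (contValue reg f ρ (op.apply c.gmem).1 + γ (op.apply c.gmem).2) := by
  obtain ⟨hne, hc⟩ := c.step_cases I M p w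
  have hsum : ∑ p' ∈ Finset.univ.erase p, ((c.step I M p w).ctl p').value reg f =
      ∑ p' ∈ Finset.univ.erase p, (c.ctl p').value reg f :=
    Finset.sum_congr rfl fun p' hp' => by rw [hne p' (Finset.ne_of_mem_erase hp')]
  rw [Config.potential_eq _ p, Config.potentialBase, Config.potentialBase, hsum]
  rcases hc with ⟨a1, a2, a3, a4, a5, a6⟩ | ⟨a1, a2, ⟨cont, a3⟩, a4, a5, a6, a7⟩ |
    ⟨q, cont, a1, a2, a3, a4, a5, a6⟩ | ⟨op', cont', a1, a2, a3, a4, a5⟩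
  · simp [Ctl.Idle, hp] at a1
  · simp [Ctl.Idle, hp] at a1
  · simp [hp] at a1
  · rw [hp] at a1
    cases a1
    rw [a2, a3]
    rcases a5 with ⟨q, b0, b1, b2⟩ | ⟨o, b0, b1, b2⟩
    · rw [b0, b1, b2]
      rfl
    -- An inequality suffices: a possible earlier result of `p` is simply dropped, so it need not be
    -- known that there was none.
    · have hr : ∑ p', resultValue ρ ((c.step I M p w).result p') ≤
          ∑ p', resultValue ρ (c.result p') + resultValue ρ (some o) := by
        rw [b2, ← Finset.add_sum_erase _ _ (Finset.mem_univ p),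
          ← Finset.add_sum_erase _ (fun p' => resultValue ρ (c.result p')) (Finset.mem_univ p),
          Function.update_self]
        have : ∑ p' ∈ Finset.univ.erase p,
            resultValue ρ (Function.update c.result p (some o) p') =
            ∑ p' ∈ Finset.univ.erase p, resultValue ρ (c.result p') :=
          Finset.sum_congr rfl fun p' hp' => by
            rw [Function.update_of_ne (Finset.ne_of_mem_erase hp')]
        rw [this, add_comm]
        gcongr
        exact le_add_self
      rw [b0, b1]
      simp only [Ctl.value, contValue, zero_add]
      calc _ ≤ _ := add_le_add_left (add_le_add_right hr _) _
        _ = _ := by ring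

/-- Under resampling the base is therefore a constant that leaves the integral over the coin. -/
theorem Config.potentialBase_modify (c : Config n Ω L V S Q R W) (p : Fin n)
    (x : Ctl L V S Q R W) (h : List (Record n Ω L V R W)) :
    (c.modify p x h).potentialBase I reg f ρ k p = c.potentialBase I reg f ρ k p := by
  rw [Config.potentialBase, Config.potentialBase]
  congr 2
  refine Finset.sum_congr rfl fun p' hp' => ?_
  simp [Config.modify, Finset.ne_of_mem_erase hp']

/-- Before the first process is poised to call `elect()`, no process has called it. -/
theorem OneTime.calls_eq_zero {A : Adversary n Ω L V R W} (hM : OneTime I M) {ω : ℕ → Ω} {t : ℕ}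
    (h : ∀ s < t, ∀ p, ¬ (advRun I M A ω s).Poised M p) :
    (∀ p, (advRun I M A ω t).calls p = 0) ∧ (advRun I M A ω t).gmem = I.init := by
  induction t with
  | zero => exact ⟨fun p => rfl, rfl⟩
  | succ t ih =>
    obtain ⟨ih1, ih2⟩ := ih fun s hs => h s (hs.trans t.lt_succ_self)
    have hP := h t t.lt_succ_self
    have hloc := hM.localInv_advRun A ω t
    rw [advRun]
    generalize advRun I M A ω t = c at *
    obtain ⟨hne, hc⟩ := c.step_cases I M (A c.hist) (ω c.flips)
    rcases hc with ⟨a1, a2, a3, a4, a5, a6⟩ | ⟨a1, a2, a3, a4, a5, a6, a7⟩ |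
      ⟨q, cont, a1, a2, a3, a4, a5, a6⟩ | ⟨op, cont, a1, a2, a3, a4, a5⟩
    · rw [a3, a4]
      exact ⟨ih1, ih2⟩
    · exact absurd a2 (hP _)
    · rw [a3, a4]
      exact ⟨ih1, ih2⟩
    · rcases hloc (A c.hist) with ⟨h', -⟩ | ⟨h', -⟩
      · simp [Ctl.Idle, a1] at h'
      · simp [ih1] at h'

variable [Countable Ω] [MeasurableSpace Ω] [DiscreteMeasurableSpace Ω]
  {A : Adversary n Ω L V R W}

/-- The first `t` steps use at most `t` coins from a countable discrete space, so no structure on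
configurations is required. -/
theorem measurable_comp_advRun {β : Type*} [MeasurableSpace β] (t : ℕ)
    (g : Config n Ω L V S Q R W → β) : Measurable fun ω => g (advRun I M A ω t) :=
  measurable_of_congr t fun ω ω' h => by
    rw [(advRun_congr I M A fun i hi => h i (hi.trans_le (flips_advRun_le I M A ω t))).1]

theorem measurableSet_advRun (t : ℕ) (P : Config n Ω L V S Q R W → Prop) :
    MeasurableSet {ω | P (advRun I M A ω t)} :=
  measurableSet_setOfPred.2 (measurable_comp_advRun t P)

open Classical in
/-- The index of the coin flip that precedes the next step, if that step is a shared memory step of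
`elect()`. -/
noncomputable def pendingFlip (I : Impl Ω Q R W) (M : Algo n Ω L V S) (A : Adversary n Ω L V R W)
    (B : Set (ℕ → Ω)) (t : ℕ) (ω : ℕ → Ω) : Option ℕ :=
  if ω ∈ B ∧ ∃ op cont, (advRun I M A ω t).ctl (A (advRun I M A ω t).hist) = .methOp op cont then
    some (lastFlip I M A ω t (A (advRun I M A ω t).hist))
  else none

/-- The expected potential does not increase. -/
theorem RWOblivious.setLIntegral_potential_succ_le (D : Measure Ω) [IsProbabilityMeasure D]
    (hA : RWOblivious I M A) (hreg : ∀ q w, (I.act q w).reg = reg q)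
    (hpot : ∀ q g, ∫⁻ w, (contValue reg f ρ ((I.act q w).apply g).1 +
      γ ((I.act q w).apply g).2) ∂D ≤ f (reg q) + γ g)
    {s t : ℕ} (hst : s ≤ t) (E : List (Record n Ω L V R W))
    (hidle : ∀ ω, (advRun I M A ω s).hist = E → ∀ p, ((advRun I M A ω s).ctl p).Idle)
    (hk : ∀ ω, (advRun I M A ω s).hist = E → ∑ p, (advRun I M A ω (t + 1)).calls p ≤ k) :
    ∫⁻ ω in {ω | (advRun I M A ω s).hist = E}, (advRun I M A ω (t + 1)).potential I reg f ρ γ k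
        ∂(Measure.infinitePi fun _ : ℕ => D) ≤
      ∫⁻ ω in {ω | (advRun I M A ω s).hist = E}, (advRun I M A ω t).potential I reg f ρ γ k
        ∂(Measure.infinitePi fun _ : ℕ => D) := by
  set B : Set (ℕ → Ω) := {ω | (advRun I M A ω s).hist = E} with hBdef
  have hB : MeasurableSet B := measurableSet_advRun s fun c => c.hist = E
  rw [← lintegral_indicator hB, ← lintegral_indicator hB]
  have hI : ∀ q w w', (I.act q w).reg = (I.act q w').reg := fun q w w' => by rw [hreg, hreg]
  have key : ∀ ω m, pendingFlip I M A B t ω = some m → ω ∈ B ∧ ∃ p q cont,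
      p = A (advRun I M A ω t).hist ∧ m = lastFlip I M A ω t p ∧
      (advRun I M A ω t).ctl p = .methOp (I.act q (ω m)) cont ∧
      ∀ w, Function.update ω m w ∈ B ∧ pendingFlip I M A B t (Function.update ω m w) = some m ∧
        (advRun I M A (Function.update ω m w) (t + 1)).potential I reg f ρ γ k ≤
          (advRun I M A ω t).potentialBase I reg f ρ k p +
            (contValue reg f ρ ((I.act q w).apply (advRun I M A ω t).gmem).1 +
              γ ((I.act q w).apply (advRun I M A ω t).gmem).2) := by
    intro ω m hm
    rw [pendingFlip] at hm
    split_ifs at hm with hω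
    obtain ⟨hωB, op, cont, hctl⟩ := hω
    simp only [Option.some.injEq] at hm
    set p := A (advRun I M A ω t).hist with hp
    obtain ⟨hlt, q, h₀, h₁, hop, hhist, hne, hw⟩ := hA.advRun_update hI t ω p op cont hctl
    rw [hm] at hlt hop hhist hw
    refine ⟨hωB, p, q, cont, rfl, hm.symm, hop ▸ hctl, fun w => ?_⟩
    obtain ⟨e1, e2⟩ := hw w
    have hAeq := hA.adversary_congr hI (hop ▸ hctl) hhist hne e1
    rw [← hp] at hAeq
    -- At time `s` process `p` was outside `elect()`, so the coin `m` was tossed afterwards and the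
    -- execution up to time `s` does not depend on it.
    have hmB : Function.update ω m w ∈ B := by
      have hle := flips_le_lastFlip I M A ω hst (hidle ω hωB p)
        (by simp [hctl, Ctl.Idle])
      rw [hm] at hle
      have := (advRun_congr I M A (ω := ω) (ω' := Function.update ω m w) (t := s) fun i hi =>
        (Function.update_of_ne (hi.trans_le hle).ne _ _).symm).1
      change (advRun I M A (Function.update ω m w) s).hist = E
      rw [← this]
      exact hωB
    have hctl' : (advRun I M A (Function.update ω m w) t).ctl p = .methOp (I.act q w) cont := by
      rw [e1]
      simp [Config.modify]
    refine ⟨hmB, ?_, ?_⟩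
    · rw [pendingFlip, hAeq, if_pos ⟨hmB, _, _, hctl'⟩, e2, hm]
    · rw [advRun, hAeq]
      refine (Config.potential_step_le _ p _ hctl').trans ?_
      rw [e1, Config.potentialBase_modify]
      rfl
  refine lintegral_le_lintegral_of_update D ((measurable_comp_advRun _ _).indicator hB)
    (pendingFlip I M A B t) (fun o => ?_) (fun ω hω => ?_) (fun ω m hω w => ?_) (fun ω m hω => ?_)
  · refine measurableSet_setOfPred.2 (measurable_of_congr t fun ω ω' h => ?_)
    have h1 := advRun_congr I M A (ω := ω) (ω' := ω') (t := t)
      fun i hi => h i (hi.trans_le (flips_advRun_le I M A ω t))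
    have h2 := advRun_congr I M A (ω := ω) (ω' := ω') (t := s)
      fun i hi => h i (hi.trans_le ((flips_advRun_le I M A ω s).trans hst))
    have hB' : ω ∈ B ↔ ω' ∈ B := by
      change (advRun I M A ω s).hist = E ↔ (advRun I M A ω' s).hist = E
      rw [h2.1]
    clear_value B
    classical
    exact congrArg (· = o) (if_congr (by rw [hB', h1.1]) (by rw [h1.1, h1.2]) rfl)
  · by_cases hB : ω ∈ B
    · rw [Set.indicator_of_mem hB, Set.indicator_of_mem hB, advRun]
      refine (Config.potential_step_eq hreg _ _ _ (hk ω hB) fun op cont h => ?_).le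
      rw [pendingFlip, if_pos ⟨hB, op, cont, h⟩] at hω
      simp at hω
    · simp [hB]
  · obtain ⟨-, p, q, cont, -, -, -, h⟩ := key ω m hω
    exact (h w).2.1
  · obtain ⟨hωB, p, q, cont, hp, hm, hctl, h⟩ := key ω m hω
    rw [Set.indicator_of_mem hωB, Config.potential_eq _ p, hctl]
    calc _ ≤ ∫⁻ w, ((advRun I M A ω t).potentialBase I reg f ρ k p +
            (contValue reg f ρ ((I.act q w).apply (advRun I M A ω t).gmem).1 +
              γ ((I.act q w).apply (advRun I M A ω t).gmem).2)) ∂D := by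
          refine lintegral_mono fun w => ?_
          rw [Set.indicator_of_mem (h w).1]
          exact (h w).2.2
      _ ≤ _ := by
          rw [lintegral_add_left measurable_const, lintegral_const, measure_univ, mul_one]
          simp only [Ctl.value, hreg]
          gcongr
          exact hpot _ _

/-- If at most `k` processes can call `elect()` in an extension of `E`, then the potential after `E`
bounds the expected value, over the extensions of `E`, of the winners and the registers. -/
theorem RWOblivious.lintegral_cond_le (D : Measure Ω) [IsProbabilityMeasure D]
    (hM : OneTime I M) (hA : RWOblivious I M A) (hreg : ∀ q w, (I.act q w).reg = reg q)
    (hpot : ∀ q g, ∫⁻ w, (contValue reg f ρ ((I.act q w).apply g).1 +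
      γ ((I.act q w).apply g).2) ∂D ≤ f (reg q) + γ g)
    {E : List (Record n Ω L V R W)} (hE : E ∈ Exec I M A k) {t : ℕ} (ht : E.length ≤ t) :
    ∫⁻ ω, (∑ p, resultValue ρ ((advRun I M A ω t).result p) + γ (advRun I M A ω t).gmem)
        ∂(cond (Measure.infinitePi fun _ : ℕ => D) (extensionEvent I M A E)) ≤
      k * f (reg I.start) + γ I.init := by
  obtain ⟨⟨ω₀, s, hEs, -, hpoised⟩, hcont⟩ := hE
  have hs : E.length = s := by rw [hEs, length_hist_advRun]
  rw [hs] at ht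
  set μ := Measure.infinitePi fun _ : ℕ => D
  set B : Set (ℕ → Ω) := {ω | (advRun I M A ω s).hist = E} with hBdef
  have hB : MeasurableSet B := measurableSet_advRun s fun c => c.hist = E
  have hext : extensionEvent I M A E = B := by
    ext ω
    rw [extensionEvent, Set.mem_ofPred_eq, prefix_hist_advRun_iff, hs]
    rfl
  have hω : ∀ ω ∈ B, advRun I M A ω s = advRun I M A ω₀ s := fun ω hω =>
    advRun_eq_of_hist_eq I M A (Eq.trans hω hEs)
  obtain ⟨hcalls, hgmem⟩ := hM.calls_eq_zero hpoised
  have hloc : ∀ p, ((advRun I M A ω₀ s).ctl p).Idle ∧ (advRun I M A ω₀ s).result p = none := by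
    intro p
    rcases hM.localInv_advRun A ω₀ s p with ⟨h1, ⟨-, -, h2⟩ | ⟨h2, -⟩⟩ | ⟨h2, -⟩
    · exact ⟨h1, h2⟩
    all_goals simp [hcalls] at h2
  have hk : ∀ ω ∈ B, ∀ t, s ≤ t → ∑ p, (advRun I M A ω t).calls p ≤ k := by
    intro ω hωB t hst
    obtain ⟨σ, hσ⟩ := exists_run_eq_advRun I M A ω t
    have hpre : E <+: (run I M σ ω).hist := by
      rw [hσ, ← show (advRun I M A ω s).hist = E from hωB]
      exact hist_advRun_prefix I M A ω hst
    have hle : Set.encard {p | 1 ≤ (run I M σ ω).calls p} ≤ k := by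
      refine le_trans ?_ hcont
      refine le_iSup_of_le σ ?_
      refine le_iSup_of_le ω ?_
      exact le_iSup_of_le hpre le_rfl
    rw [← hσ]
    -- Every count is `0` or `1`, so the number of calls equals the number of callers, which
    -- max-contention bounds.
    have hsum : ∑ p, (run I M σ ω).calls p =
        (Finset.univ.filter fun p => 1 ≤ (run I M σ ω).calls p).card := by
      rw [Finset.card_filter]
      refine Finset.sum_congr rfl fun p _ => ?_
      have := hM σ ω p
      split_ifs <;> omega
    rw [hsum]
    have hco : {p | 1 ≤ (run I M σ ω).calls p} =
        ((Finset.univ.filter fun p => 1 ≤ (run I M σ ω).calls p : Finset (Fin n)) : Set (Fin n)) := by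
      ext; simp
    rw [hco, Set.encard_coe_eq_coe_finsetCard] at hle
    exact_mod_cast hle
  -- On `B` the configuration at time `s` is fixed, with no calls and initial registers, so its
  -- potential is exactly the claimed bound.
  have hmain : ∫⁻ ω in B, (advRun I M A ω t).potential I reg f ρ γ k ∂μ ≤
      (k * f (reg I.start) + γ I.init) * μ B := by
    induction t, ht using Nat.le_induction with
    | base =>
      rw [← setLIntegral_const]
      refine setLIntegral_mono_ae' hB (Filter.Eventually.of_forall fun ω hωB => ?_)
      rw [hω ω hωB, Config.potential]
      simp only [(hloc _).1.value_eq, (hloc _).2, hcalls, hgmem]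
      simp [resultValue]
    | succ t hst ih =>
      refine le_trans (hA.setLIntegral_potential_succ_le D hreg hpot hst E ?_ ?_) ih
      · intro ω hωB p
        rw [hω ω hωB]
        exact (hloc p).1
      · exact fun ω hωB => hk ω hωB (t + 1) (by omega)
  rw [hext, ProbabilityTheory.cond, lintegral_smul_measure, smul_eq_mul]
  calc _ ≤ (μ B)⁻¹ * ((k * f (reg I.start) + γ I.init) * μ B) := by
        gcongr
        refine le_trans (lintegral_mono fun ω => ?_) hmain
        rw [Config.potential, add_assoc]
        exact le_add_self
    _ = (k * f (reg I.start) + γ I.init) * ((μ B)⁻¹ * μ B) := by ring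
    _ ≤ (k * f (reg I.start) + γ I.init) * 1 := by
        gcongr
        -- Only `≤` holds in general: if `B` is null, the conditional measure is zero.
        exact ENNReal.inv_mul_le_one _
    _ = _ := mul_one _

end Potential

/-! ### Progress of a call, seen through the register it accesses next -/

section Place

variable {n : ℕ} {Ω L V S Q R W : Type*}

/-- The register that a process inside an `elect()` call accesses next. -/
def Ctl.place (reg : Q → R) : Ctl L V S Q R W → Option R
  | .meth q _ => some (reg q)
  | .methOp op _ => some op.reg
  | _ => none

theorem Ctl.Idle.place_eq {reg : Q → R} {x : Ctl L V S Q R W} (h : x.Idle) :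
    x.place reg = none := by
  rcases h with ⟨s, rfl⟩ | ⟨op, rfl⟩ <;> rfl

/-- The situation after a step of `p`, in terms of the registers that the processes access next. -/
theorem OneTime.place_cases {I : Impl Ω Q R W} {M : Algo n Ω L V S} (hM : OneTime I M)
    {reg : Q → R} (hreg : ∀ q w, (I.act q w).reg = reg q) (σ : List (Fin n)) (ω : ℕ → Ω)
    (p : Fin n) {c c' : Config n Ω L V S Q R W} (hc : c = run I M σ ω)
    (hc' : c' = run I M (σ ++ [p]) ω) :
    (∀ p', p' ≠ p → (c'.ctl p').place reg = (c.ctl p').place reg ∧ c'.steps p' = c.steps p') ∧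
    (((c'.ctl p).place reg = (c.ctl p).place reg ∧ c'.gmem = c.gmem ∧ c'.calls = c.calls ∧
        c'.steps = c.steps) ∨
      ((c.ctl p).place reg = none ∧ c.steps p = 0 ∧ (c'.ctl p).place reg = some (reg I.start) ∧
        c'.gmem = c.gmem ∧ c'.steps = c.steps) ∨
      ∃ q w, (c.ctl p).place reg = some (reg q) ∧ c'.gmem = ((I.act q w).apply c.gmem).2 ∧
        c'.calls = c.calls ∧ c'.steps p = c.steps p + 1 ∧
        ((∃ q', ((I.act q w).apply c.gmem).1 = .inl q' ∧
            (c'.ctl p).place reg = some (reg q')) ∨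
          ∃ o, ((I.act q w).apply c.gmem).1 = .inr o ∧ (c'.ctl p).place reg = none ∧
            c'.result p = some o)) := by
  have hone := hM (σ ++ [p]) ω p
  rw [← hc'] at hone
  have hloc := hM.localInv σ ω p
  rw [run_append, ← hc] at hc'
  rw [← hc] at hloc
  obtain ⟨hne, hcase⟩ := c.step_cases I M p (ω c.flips)
  rw [← hc'] at hne hcase
  rcases hcase with ⟨a1, a2, a3, a4, a5, a6⟩ | ⟨a1, a2, ⟨cont, a3⟩, a4, a5, a6, a7⟩ |
    ⟨q, cont, a1, a2, a3, a4, a5, a6⟩ | ⟨op, cont, a1, a2, a3, a4, a5⟩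
  · refine ⟨fun p' hp' => by rw [hne p' hp', a5]; exact ⟨rfl, rfl⟩, Or.inl ?_⟩
    exact ⟨by rw [a1.place_eq, a2.place_eq], a3, a4, a5⟩
  · refine ⟨fun p' hp' => by rw [hne p' hp', a6]; exact ⟨rfl, rfl⟩, Or.inr (Or.inl ?_)⟩
    rw [a5, Function.update_self] at hone
    refine ⟨a1.place_eq, ?_, by rw [a3]; simp [Ctl.place, hreg], a4, a6⟩
    rcases hloc with ⟨-, ⟨-, h, -⟩ | ⟨h, -⟩⟩ | ⟨h, -⟩
    · exact h
    · omega
    · omega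
  · refine ⟨fun p' hp' => by rw [hne p' hp', a5]; exact ⟨rfl, rfl⟩, Or.inl ?_⟩
    exact ⟨by rw [a1, a2]; simp [Ctl.place, hreg], a3, a4, a5⟩
  · refine ⟨fun p' hp' => by rw [hne p' hp', a4, Function.update_of_ne hp']; exact ⟨rfl, rfl⟩,
      Or.inr (Or.inr ?_)⟩
    rcases hloc with ⟨h, -⟩ | ⟨-, -, ⟨q, cont', h⟩ | ⟨q, w, cont', h⟩⟩
    · simp [Ctl.Idle, a1] at h
    · simp [a1] at h
    · rw [a1] at h
      cases h
      refine ⟨q, w, by rw [a1]; simp [Ctl.place, hreg], a2, a3, by rw [a4, Function.update_self],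
        ?_⟩
      rcases a5 with ⟨q', b0, b1, b2⟩ | ⟨o, b0, b1, b2⟩
      · exact Or.inl ⟨q', b0, by rw [b1]; rfl⟩
      · exact Or.inr ⟨o, b0, by rw [b1]; rfl, by rw [b2, Function.update_self]⟩

end Place

/-! ### Deterministic properties of the sifting algorithm -/

section Sift

variable {n : ℕ} {Ω L V S : Type*} {ℓ : ℕ} {H : ℕ → Set Ω}

/-- The register accessed in a round of the sifting algorithm. -/
def SiftState.reg : SiftState → SiftReg
  | .backward i => .up i
  | .forward i => .down i

/-- The index of a round of the sifting algorithm. -/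
def SiftState.index : SiftState → ℕ
  | .backward i => i
  | .forward i => i

theorem sift_act_reg (q : SiftState) (w : Ω) : ((sift ℓ H).act q w).reg = q.reg := by
  cases q <;> simp only [sift, SiftState.reg] <;> split_ifs <;> rfl

open Classical in
/-- The possible effects of a shared memory step of the sifting algorithm. -/
theorem sift_apply (q : SiftState) (w : Ω) (g : SiftReg → Bool) :
    (g q.reg = true ∧ ((sift ℓ H).act q w).apply g = (.inr .lose, g)) ∨
    ((((sift ℓ H).act q w).apply g).1 = siftLoop q.index ∧
      ((((sift ℓ H).act q w).apply g).2 = g ∨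
        (((sift ℓ H).act q w).apply g).2 = Function.update g q.reg true)) ∨
    ∃ i, q = .backward i ∧ i ≠ ℓ ∧ ((sift ℓ H).act q w).apply g =
      (.inl (.backward (i + 1)), Function.update g (.up i) true) := by
  rcases q with i | i
  · by_cases hw : w ∈ H i
    · by_cases hi : i = ℓ
      · subst hi
        simp [sift, Op.apply, SiftState.reg, SiftState.index, hw]
      · simp [sift, Op.apply, SiftState.reg, hw, hi]
    · cases hg : g (.up i) <;> simp [sift, Op.apply, SiftState.reg, SiftState.index, hw, hg]
  · by_cases hw : w ∈ H i
    · simp [sift, Op.apply, SiftState.reg, SiftState.index, hw]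
    · cases hg : g (.down i) <;> simp [sift, Op.apply, SiftState.reg, SiftState.index, hw, hg]

/-- The registers only change from `0` to `1`. -/
theorem sift_apply_mono (q : SiftState) (w : Ω) {g : SiftReg → Bool} {x : SiftReg}
    (hx : g x = true) : (((sift ℓ H).act q w).apply g).2 x = true := by
  classical
  have hu : ∀ y, Function.update g y true x = true := fun y => by
    by_cases h : x = y
    · rw [h, Function.update_self]
    · rwa [Function.update_of_ne h]
  rcases sift_apply (ℓ := ℓ) (H := H) q w g with ⟨-, h⟩ | ⟨-, h | h⟩ | ⟨i, -, -, h⟩ <;> rw [h]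
  exacts [hx, hx, hu _, hu _]

theorem siftLoop_cases (i : ℕ) :
    (1 < i ∧ siftLoop i = .inl (.forward (i - 1))) ∨ (i ≤ 1 ∧ siftLoop i = .inr .win) := by
  unfold siftLoop
  split_ifs with h
  · exact Or.inl ⟨h, rfl⟩
  · exact Or.inr ⟨by omega, rfl⟩

/-- The relation between the number of shared memory steps `s` of a process, the register `x` it
accesses next, and the registers written in the backward phase: `j` is an index that the process has
reached. -/
def StepsInv (ℓ : ℕ) (g : SiftReg → Bool) (x : Option SiftReg) (s : ℕ) : Prop :=
  ∃ j, 1 ≤ j ∧ j ≤ ℓ ∧ (∀ r, 1 ≤ r → r < j → g (.up r) = true) ∧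
    match x with
    | none => s + 1 ≤ 2 * j
    | some (.up i) => i = j ∧ s + 1 ≤ j
    | some (.down i) => 1 ≤ i ∧ i < j ∧ s + 1 + i ≤ 2 * j

theorem StepsInv.mono {g g' : SiftReg → Bool} {x : Option SiftReg} {s : ℕ}
    (h : StepsInv ℓ g x s) (hg : ∀ r, g (.up r) = true → g' (.up r) = true) :
    StepsInv ℓ g' x s := by
  obtain ⟨j, h1, h2, h3, h4⟩ := h
  exact ⟨j, h1, h2, fun r hr hr' => hg r (h3 r hr hr'), h4⟩

/-- The witness `j` increases only when the process writes `Up[j]` and moves on backward. Any other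
step keeps `j`, and the forward phase adds at most `j - 1` steps to the `j` already made. -/
theorem StepsInv.act {g : SiftReg → Bool} {q : SiftState} {s : ℕ}
    (h : StepsInv ℓ g (some q.reg) s) (w : Ω) :
    (∀ q', (((sift ℓ H).act q w).apply g).1 = .inl q' →
      StepsInv ℓ (((sift ℓ H).act q w).apply g).2 (some q'.reg) (s + 1)) ∧
    ∀ o, (((sift ℓ H).act q w).apply g).1 = .inr o →
      StepsInv ℓ (((sift ℓ H).act q w).apply g).2 none (s + 1) := by
  have hmono : ∀ x s, StepsInv ℓ g x s → StepsInv ℓ (((sift ℓ H).act q w).apply g).2 x s :=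
    fun x s h => h.mono fun r => sift_apply_mono q w
  rcases sift_apply (ℓ := ℓ) (H := H) q w g with ⟨-, h'⟩ | ⟨h', -⟩ | ⟨i, rfl, hi, h'⟩
  · rw [h']
    refine ⟨by simp, fun o _ => ?_⟩
    obtain ⟨j, h1, h2, h3, h4⟩ := h
    refine ⟨j, h1, h2, h3, ?_⟩
    rcases q with i | i <;> simp only [SiftState.reg] at h4 ⊢ <;> omega
  · rw [h']
    obtain ⟨j, h1, h2, h3, h4⟩ := h
    rcases siftLoop_cases q.index with ⟨hq, h''⟩ | ⟨hq, h''⟩ <;> rw [h'']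
    · refine ⟨fun q' hq' => ?_, by simp⟩
      cases hq'
      refine hmono _ _ ⟨j, h1, h2, h3, ?_⟩
      rcases q with i | i <;> simp only [SiftState.reg, SiftState.index] at h4 hq ⊢ <;> omega
    · refine ⟨by simp, fun o _ => hmono _ _ ⟨j, h1, h2, h3, ?_⟩⟩
      rcases q with i | i <;> simp only [SiftState.reg, SiftState.index] at h4 hq ⊢ <;> omega
  · rw [h']
    refine ⟨fun q' hq' => ?_, by simp⟩
    cases hq'
    obtain ⟨j, h1, h2, h3, rfl, h4⟩ := h
    refine ⟨i + 1, by omega, by omega, fun r hr hr' => ?_, rfl, by omega⟩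
    by_cases hri : r = i
    · subst hri
      simp
    · classical
      change Function.update g _ _ _ = true
      rw [Function.update_of_ne (by simpa using hri)]
      exact h3 r hr (by omega)

/-- Steps of other processes are harmless since registers are never reset. -/
theorem OneTime.stepsInv {M : Algo n Ω L V S} (hM : OneTime (sift ℓ H) M) (hℓ : 1 ≤ ℓ)
    (σ : List (Fin n)) (ω : ℕ → Ω) (p : Fin n) :
    StepsInv ℓ (run (sift ℓ H) M σ ω).gmem (((run (sift ℓ H) M σ ω).ctl p).place SiftState.reg)
      ((run (sift ℓ H) M σ ω).steps p) := by
  induction σ using List.reverseRecOn with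
  | nil => exact ⟨1, le_rfl, hℓ, fun r h1 h2 => by omega, by simp [run, Config.initial, Ctl.place]⟩
  | append_singleton σ p' ih =>
    obtain ⟨hne, hc⟩ := hM.place_cases sift_act_reg σ ω p' rfl rfl
    generalize run (sift ℓ H) M σ ω = c at *
    generalize run (sift ℓ H) M (σ ++ [p']) ω = c' at *
    by_cases hp : p = p'
    · subst hp
      rcases hc with ⟨a1, a2, a3, a4⟩ | ⟨a1, a2, a3, a4, a5⟩ | ⟨q, w, a1, a2, a3, a4, a5⟩
      · rwa [a1, a2, a4]
      · rw [a3, a5, a2]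
        exact ⟨1, le_rfl, hℓ, fun r h1 h2 => by omega, rfl, le_rfl⟩
      · rw [a1] at ih
        have hact := ih.act (H := H) w
        rw [a2, a4]
        rcases a5 with ⟨q', b1, b2⟩ | ⟨o, b1, b2, b3⟩
        · rw [b2]
          exact hact.1 q' b1
        · rw [b2]
          exact hact.2 o b1
    · rw [(hne p hp).1, (hne p hp).2]
      refine ih.mono fun r hr => ?_
      rcases hc with ⟨a1, a2, a3, a4⟩ | ⟨a1, a2, a3, a4, a5⟩ | ⟨q, w, a1, a2, a3, a4, a5⟩
      · rwa [a2]
      · rwa [a4]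
      · rw [a2]
        exact sift_apply_mono q w hr

/-- The number of registers of the array `Up` with index less than `ℓ` that have been written. -/
def upCount (ℓ : ℕ) (g : SiftReg → Bool) : ℕ :=
  ∑ r ∈ Finset.Ico 1 ℓ, if g (.up r) = true then 1 else 0

/-- With `j` from the invariant, `j - 1` entries are known to be written and at most `2 j - 1` steps
were made. -/
theorem OneTime.steps_le {M : Algo n Ω L V S} (hM : OneTime (sift ℓ H) M) (hℓ : 1 ≤ ℓ)
    (A : Adversary n Ω L V SiftReg Bool) (ω : ℕ → Ω) (t : ℕ) (p : Fin n) :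
    (advRun (sift ℓ H) M A ω t).steps p ≤
      1 + 2 * upCount ℓ (advRun (sift ℓ H) M A ω t).gmem := by
  obtain ⟨σ, hσ⟩ := exists_run_eq_advRun (sift ℓ H) M A ω t
  have := hM.stepsInv hℓ σ ω p
  rw [hσ] at this
  generalize advRun (sift ℓ H) M A ω t = c at *
  obtain ⟨j, h1, h2, h3, h4⟩ := this
  have hj : j - 1 ≤ upCount ℓ c.gmem := by
    calc j - 1 = ∑ r ∈ Finset.Ico 1 j, 1 := by simp
      _ = ∑ r ∈ Finset.Ico 1 j, if c.gmem (.up r) = true then 1 else 0 :=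
          Finset.sum_congr rfl fun r hr => by
            rw [Finset.mem_Ico] at hr
            rw [if_pos (h3 r hr.1 hr.2)]
      _ ≤ _ := Finset.sum_le_sum_of_subset (Finset.Ico_subset_Ico_right h2)
  have : c.steps p + 1 ≤ 2 * j := by
    rcases h : (c.ctl p).place SiftState.reg with _ | (i | i) <;> simp only [h] at h4 <;> omega
  omega

theorem OneTime.gmem_advRun_mono {M : Algo n Ω L V S} (hM : OneTime (sift ℓ H) M)
    (A : Adversary n Ω L V SiftReg Bool) (ω : ℕ → Ω) {s t : ℕ} (hst : s ≤ t) {x : SiftReg}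
    (hx : (advRun (sift ℓ H) M A ω s).gmem x = true) :
    (advRun (sift ℓ H) M A ω t).gmem x = true := by
  induction t, hst using Nat.le_induction with
  | base => exact hx
  | succ t _ ih =>
    obtain ⟨σ, hσ⟩ := exists_run_eq_advRun (sift ℓ H) M A ω t
    have hσ' : run (sift ℓ H) M (σ ++ [A (advRun (sift ℓ H) M A ω t).hist]) ω =
        advRun (sift ℓ H) M A ω (t + 1) := by rw [run_append, hσ, advRun]
    obtain ⟨-, hc⟩ := hM.place_cases sift_act_reg σ ω _ hσ.symm hσ'.symm
    rcases hc with ⟨a1, a2, a3, a4⟩ | ⟨a1, a2, a3, a4, a5⟩ | ⟨q, w, a1, a2, a3, a4, a5⟩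
    · rwa [a2]
    · rwa [a4]
    · rw [a2]
      exact sift_apply_mono q w ih

/-- The position of a register in the order in which a process passes the registers. -/
def SiftReg.pos (ℓ : ℕ) : SiftReg → ℕ
  | .up i => i
  | .down i => 2 * ℓ - i

/-- Every written register has been passed by a process that has not lost, and if `elect()` has been
called then some process has not lost. -/
theorem OneTime.exists_not_lost {M : Algo n Ω L V S} (hM : OneTime (sift ℓ H) M) (hℓ : 1 ≤ ℓ)
    (σ : List (Fin n)) (ω : ℕ → Ω) {c : Config n Ω L V S SiftState SiftReg Bool}
    (hc : c = run (sift ℓ H) M σ ω) :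
    (∃ p, c.result p = some .win) ∨
    (∀ y, c.gmem y = true →
      ∃ p x, (c.ctl p).place SiftState.reg = some x ∧ y.pos ℓ < x.pos ℓ) ∧
    ((∃ p, 1 ≤ c.calls p) → ∃ p x, (c.ctl p).place SiftState.reg = some x) := by
  classical
  induction σ using List.reverseRecOn generalizing c with
  | nil =>
    subst hc
    right
    simp [run, Config.initial, sift]
  | append_singleton σ p ih =>
    rcases ih rfl with ⟨p₁, ih⟩ | ⟨ih1, ih2⟩
    · left
      refine ⟨p₁, ?_⟩
      rw [hc, run_append]
      exact hM.result_step σ ω p₁ p _ ih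
    · have hinv := hM.stepsInv hℓ σ ω p
      obtain ⟨hne, hcase⟩ := hM.place_cases sift_act_reg σ ω p rfl hc
      generalize run (sift ℓ H) M σ ω = c₀ at *
      -- If `p` moves strictly forward and at most its own register becomes written, then `p`
      -- remains a witness wherever it was one and witnesses the new write too.
      have hadv : ∀ x x', (c₀.ctl p).place SiftState.reg = some x →
          (c.ctl p).place SiftState.reg = some x' → x.pos ℓ < x'.pos ℓ →
          (∀ y, c.gmem y = true → y = x ∨ c₀.gmem y = true) →
          (∀ y, c.gmem y = true →
            ∃ p x, (c.ctl p).place SiftState.reg = some x ∧ y.pos ℓ < x.pos ℓ) ∧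
          ((∃ p, 1 ≤ c.calls p) → ∃ p x, (c.ctl p).place SiftState.reg = some x) := by
        intro x x' hx hx' hlt hg
        refine ⟨fun y hy => ?_, fun _ => ⟨p, x', hx'⟩⟩
        rcases hg y hy with rfl | hy
        · exact ⟨p, x', hx', hlt⟩
        · obtain ⟨p₁, x₁, h1, h2⟩ := ih1 y hy
          by_cases hp : p₁ = p
          · subst hp
            rw [hx] at h1
            cases h1
            exact ⟨p₁, x', hx', h2.trans hlt⟩
          · exact ⟨p₁, x₁, by rw [(hne p₁ hp).1, h1], h2⟩
      rcases hcase with ⟨a1, a2, a3, a4⟩ | ⟨a1, a2, a3, a4, a5⟩ | ⟨q, w, a1, a2, a3, a4, a5⟩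
      · right
        have hall : ∀ p', (c.ctl p').place SiftState.reg = (c₀.ctl p').place SiftState.reg := by
          intro p'
          by_cases hp : p' = p
          · rw [hp, a1]
          · exact (hne p' hp).1
        simp only [hall, a2, a3]
        exact ⟨ih1, ih2⟩
      · right
        refine ⟨fun y hy => ?_, fun _ => ⟨p, _, a3⟩⟩
        rw [a4] at hy
        obtain ⟨p₁, x₁, h1, h2⟩ := ih1 y hy
        by_cases hp : p₁ = p
        · subst hp
          simp [a1] at h1
        · exact ⟨p₁, x₁, by rw [(hne p₁ hp).1, h1], h2⟩
      · rw [a1] at hinv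
        obtain ⟨j, h1, h2, -, h4⟩ := hinv
        rcases sift_apply (ℓ := ℓ) (H := H) q w c₀.gmem with ⟨b1, b2⟩ | ⟨b1, b2⟩ | ⟨i, rfl, hi, b2⟩
        · right
          -- Here `p` loses. The register it reads is written, hence already passed by some `p₂`.
          -- This is not `p`, which is only at that register, and `p₂` takes over every register
          -- witnessed by `p`.
          obtain ⟨p₂, x₂, h5, h6⟩ := ih1 _ b1
          have hp₂ : p₂ ≠ p := by
            rintro rfl
            rw [a1] at h5
            cases h5
            exact lt_irrefl _ h6
          refine ⟨fun y hy => ?_, fun _ => ⟨p₂, x₂, by rw [(hne p₂ hp₂).1, h5]⟩⟩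
          rw [a2, b2] at hy
          obtain ⟨p₁, x₁, h7, h8⟩ := ih1 y hy
          by_cases hp : p₁ = p
          · subst hp
            rw [a1] at h7
            cases h7
            exact ⟨p₂, x₂, by rw [(hne p₂ hp₂).1, h5], h8.trans h6⟩
          · exact ⟨p₁, x₁, by rw [(hne p₁ hp).1, h7], h8⟩
        · have hg : ∀ y, c.gmem y = true → y = q.reg ∨ c₀.gmem y = true := by
            intro y hy
            by_cases hyq : y = q.reg
            · exact Or.inl hyq
            · right
              rw [a2] at hy
              rcases b2 with b2 | b2 <;> rw [b2] at hy
              · exact hy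
              · rwa [Function.update_of_ne hyq] at hy
          rcases siftLoop_cases q.index with ⟨hq, b3⟩ | ⟨hq, b3⟩ <;> rw [b1, b3] at a5
          · right
            rcases a5 with ⟨q', b4, b5⟩ | ⟨o, b4, -⟩
            · cases b4
              refine hadv _ _ a1 b5 ?_ hg
              -- The step bounds `i ≤ ℓ` in `h4` place every `Down` position beyond every `Up`
              -- position.
              rcases q with i | i <;>
                simp only [SiftState.reg, SiftState.index, SiftReg.pos] at h4 hq ⊢ <;> omega
            · cases b4
          · left
            rcases a5 with ⟨q', b4, b5⟩ | ⟨o, b4, -, b5⟩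
            · cases b4
            · cases b4
              exact ⟨p, b5⟩
        · right
          rw [b2] at a5
          rcases a5 with ⟨q', b4, b5⟩ | ⟨o, b4, -⟩
          · cases b4
            refine hadv _ _ a1 b5 (Nat.lt_succ_self _) fun y hy => ?_
            rw [a2, b2] at hy
            by_cases hyq : y = .up i
            · exact Or.inl hyq
            · right
              simpa [Function.update_of_ne hyq] using hy
          · cases b4

/-- The sifting algorithm implements group election. -/
theorem OneTime.notAllLose {M : Algo n Ω L V S} (hM : OneTime (sift ℓ H) M) (hℓ : 1 ≤ ℓ) :
    NotAllLose (sift ℓ H) M := by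
  intro σ ω hcall hret
  rcases hM.exists_not_lost hℓ σ ω rfl with h | ⟨-, h⟩
  · exact h
  · obtain ⟨p, x, hx⟩ := h hcall
    rcases hM.localInv σ ω p with ⟨h', -⟩ | ⟨h1, h2, -⟩
    · simp [h'.place_eq] at hx
    · exact absurd h2 (hret p h1.ge)

end Sift

/-! ### The two potentials of the sifting algorithm -/

section SiftPotential

variable {n : ℕ} {Ω L V S : Type*} {ℓ : ℕ} {H : ℕ → Set Ω}

-- In this form the coin enters only through one case distinction, as `lintegral_comp_ite` requires.
open Classical in
theorem sift_backward_apply (i : ℕ) (w : Ω) (g : SiftReg → Bool) :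
    ((sift ℓ H).act (.backward i) w).apply g =
      if w ∈ H i then
        (if i = ℓ then siftLoop i else .inl (.backward (i + 1)), Function.update g (.up i) true)
      else (if g (.up i) = true then .inr .lose else siftLoop i, g) := by
  by_cases hw : w ∈ H i <;> simp [sift, Op.apply, hw]

open Classical in
theorem sift_forward_apply (i : ℕ) (w : Ω) (g : SiftReg → Bool) :
    ((sift ℓ H).act (.forward i) w).apply g =
      if w ∈ H i then (siftLoop i, Function.update g (.down i) true)
      else (if g (.down i) = true then .inr .lose else siftLoop i, g) := by
  by_cases hw : w ∈ H i <;> simp [sift, Op.apply, hw]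

variable [MeasurableSpace Ω]

open Classical in
theorem lintegral_comp_ite [DiscreteMeasurableSpace Ω] (D : Measure Ω) (s : Set Ω) {β : Type*} (φ : β → ℝ≥0∞) (x y : β) :
    ∫⁻ w, φ (if w ∈ s then x else y) ∂D = φ x * D s + φ y * D sᶜ := by
  have hs : MeasurableSet s := .of_discrete
  rw [← lintegral_add_compl _ hs,
    setLIntegral_congr_fun hs (g := fun _ => φ x) fun w hw => by simp [hw],
    setLIntegral_congr_fun hs.compl (g := fun _ => φ y) fun w hw => by
      simp [show w ∉ s from hw],
    setLIntegral_const, setLIntegral_const]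

variable (D : Measure Ω)

/-- The probability that a process chooses heads in all rounds `1, …, i`. -/
noncomputable def headsProd (D : Measure Ω) (H : ℕ → Set Ω) (i : ℕ) : ℝ≥0∞ :=
  ∏ j ∈ Finset.Ico 1 (i + 1), D (H j)

/-- The probability that a process about to start round `i` of the backward phase makes writes
only until it returns. -/
noncomputable def upValue (D : Measure Ω) (H : ℕ → Set Ω) (ℓ i : ℕ) : ℝ≥0∞ :=
  (∏ j ∈ Finset.Ico i (ℓ + 1), D (H j)) * headsProd D H (ℓ - 1)

/-- The value of an `elect()` call for the number of winners. -/
noncomputable def winValue (D : Measure Ω) (H : ℕ → Set Ω) (ℓ : ℕ) : SiftReg → ℝ≥0∞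
  | .up i => if 1 ≤ i ∧ i ≤ ℓ then upValue D H ℓ i else ⊤
  | .down i => if 1 ≤ i ∧ i ≤ ℓ then headsProd D H i else ⊤

/-- The value of an unwritten register with index `i` for the number of winners. -/
noncomputable def regValue (D : Measure Ω) (H : ℕ → Set Ω) (i : ℕ) : ℝ≥0∞ :=
  headsProd D H (i - 1) / D (H i)

/-- The value of all unwritten registers for the number of winners. -/
noncomputable def winRegValue (D : Measure Ω) (H : ℕ → Set Ω) (ℓ : ℕ) (g : SiftReg → Bool) :
    ℝ≥0∞ :=
  ∑ i ∈ Finset.Icc 1 ℓ, (if g (.up i) = true then 0 else regValue D H i) +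
    ∑ i ∈ Finset.Icc 1 ℓ, (if g (.down i) = true then 0 else regValue D H i)

theorem headsProd_zero : headsProd D H 0 = 1 := by simp [headsProd]

theorem headsProd_succ (i : ℕ) : headsProd D H (i + 1) = headsProd D H i * D (H (i + 1)) := by
  rw [headsProd, Finset.prod_Ico_succ_top (by omega), headsProd]

/-- For `i = 1` the product is empty and matches the value `1` of a win. -/
theorem contValue_siftLoop {i : ℕ} (h1 : 1 ≤ i) (h2 : i ≤ ℓ) :
    contValue SiftState.reg (winValue D H ℓ) 1 (siftLoop i) = headsProd D H (i - 1) := by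
  rcases siftLoop_cases i with ⟨hi, h⟩ | ⟨hi, h⟩ <;> rw [h]
  · simp only [contValue, SiftState.reg, winValue]
    rw [if_pos ⟨by omega, by omega⟩]
  · have : i = 1 := by omega
    subst this
    rw [Nat.sub_self, headsProd_zero]
    rfl

-- Isolates the deposit that a write to `x` forfeits.
open Classical in
theorem winRegValue_split {i : ℕ} (h1 : 1 ≤ i) (h2 : i ≤ ℓ) (g : SiftReg → Bool) (x : SiftReg)
    (hx : x = .up i ∨ x = .down i) :
    winRegValue D H ℓ g = winRegValue D H ℓ (Function.update g x true) +
      if g x = true then 0 else regValue D H i := by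
  have hmem : i ∈ Finset.Icc 1 ℓ := Finset.mem_Icc.2 ⟨h1, h2⟩
  have aux : ∀ (r : ℕ → SiftReg), Function.Injective r →
      ∑ j ∈ Finset.Icc 1 ℓ, (if g (r j) = true then 0 else regValue D H j) =
        ∑ j ∈ Finset.Icc 1 ℓ, (if Function.update g (r i) true (r j) = true then 0
          else regValue D H j) + if g (r i) = true then 0 else regValue D H i := by
    intro r hr
    rw [← Finset.add_sum_erase _ _ hmem, ← Finset.add_sum_erase _ (fun j =>
      if Function.update g (r i) true (r j) = true then 0 else regValue D H j) hmem,
      Function.update_self, if_pos rfl, zero_add, add_comm]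
    congr 1
    refine Finset.sum_congr rfl fun j hj => ?_
    rw [Function.update_of_ne fun h => Finset.ne_of_mem_erase hj (hr h)]
  rcases hx with rfl | rfl
  · have h := aux .up fun a b hab => by simpa using hab
    simp only [winRegValue]
    rw [h]
    simp only [Function.update_of_ne (show SiftReg.down _ ≠ .up i by simp)]
    ring
  · have h := aux .down fun a b hab => by simpa using hab
    simp only [winRegValue]
    rw [h]
    simp only [Function.update_of_ne (show SiftReg.up _ ≠ .down i by simp)]
    ring

/-- The value of an `elect()` call for the event that `Up[r]` is written. -/
noncomputable def upWrittenValue (D : Measure Ω) (H : ℕ → Set Ω) (r : ℕ) : SiftReg → ℝ≥0∞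
  | .up i => if i ≤ r then ∏ j ∈ Finset.Ico i (r + 1), D (H j) else 0
  | .down _ => 0

/-- Once the backward phase is over, the call never writes to `Up` again. -/
theorem contValue_upWrittenValue_siftLoop (r i : ℕ) :
    contValue SiftState.reg (upWrittenValue D H r) 0 (siftLoop i) = 0 := by
  rcases siftLoop_cases i with ⟨-, h⟩ | ⟨-, h⟩ <;> rw [h] <;> rfl

variable [DiscreteMeasurableSpace Ω] [IsProbabilityMeasure D]

/-- The expected value does not increase in a round in which a process writes to an array entry with
probability `D s`, and otherwise passes only if that entry is still unwritten. -/
theorem round_value_le (s : Set Ω) (v : Bool) {a b c rest : ℝ≥0∞} (hc : b ≤ c * D s) :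
    (a + rest) * D s +
        ((if v = true then 0 else b) + (rest + if v = true then 0 else c)) * D sᶜ ≤
      a * D s + (rest + if v = true then 0 else c) := by
  have hs : MeasurableSet s := .of_discrete
  have hsum : D s + D sᶜ = 1 := prob_add_prob_compl hs
  cases v
  · simp only [Bool.false_eq_true, if_false]
    have hb : b * D sᶜ ≤ c * D s := by
      calc b * D sᶜ ≤ b * 1 := by gcongr; exact prob_le_one
        _ ≤ c * D s := by rwa [mul_one]
    calc _ = a * D s + rest * (D s + D sᶜ) + (b * D sᶜ + c * D sᶜ) := by ring
      _ ≤ a * D s + rest * (D s + D sᶜ) + (c * D s + c * D sᶜ) := by gcongr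
      _ = a * D s + rest * (D s + D sᶜ) + c * (D s + D sᶜ) := by ring
      _ = _ := by rw [hsum]; ring
  · simp only [if_true]
    calc _ = a * D s + rest * (D s + D sᶜ) := by ring
      _ ≤ _ := by rw [hsum]; simp

/-- Heads is already accounted for in the value of the call. Tails on an unwritten register raises
the value to `headsProd D H (i - 1)`; since heads would forfeit the deposit `regValue D H i` with
probability `D (H i)`, the expected loss covers this gain. Tails on a written register loses the
call. -/
theorem winValue_supermartingale (hH : ∀ i, 1 ≤ i → i ≤ ℓ → D (H i) ≠ 0) (q : SiftState)
    (g : SiftReg → Bool) :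
    ∫⁻ w, (contValue SiftState.reg (winValue D H ℓ) 1 (((sift ℓ H).act q w).apply g).1 +
      winRegValue D H ℓ (((sift ℓ H).act q w).apply g).2) ∂D ≤
      winValue D H ℓ q.reg + winRegValue D H ℓ g := by
  classical
  have hreg : ∀ i, 1 ≤ i → i ≤ ℓ → headsProd D H (i - 1) ≤ regValue D H i * D (H i) := by
    intro i h1 h2
    rw [regValue, ENNReal.div_mul_cancel (hH i h1 h2) (measure_ne_top _ _)]
  rcases q with i | i
  · simp only [SiftState.reg, winValue]
    split_ifs with hi
    swap
    -- Outside `[1, ℓ]` the value is `⊤` and nothing is to be proved; such states need not be shown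
    -- unreachable.
    · simp
    obtain ⟨h1, h2⟩ := hi
    simp only [sift_backward_apply]
    rw [lintegral_comp_ite D (H i) fun x : (SiftState ⊕ Outcome) × (SiftReg → Bool) =>
      contValue SiftState.reg (winValue D H ℓ) 1 x.1 + winRegValue D H ℓ x.2]
    have hheads : contValue SiftState.reg (winValue D H ℓ) 1
        (if i = ℓ then siftLoop i else .inl (.backward (i + 1))) = upValue D H ℓ (i + 1) := by
      split_ifs with hi
      · subst hi
        rw [contValue_siftLoop D h1 h2]
        simp [upValue]
      · simp only [contValue, SiftState.reg, winValue]
        rw [if_pos ⟨by omega, by omega⟩]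
    have htails : contValue SiftState.reg (winValue D H ℓ) 1
        (if g (.up i) = true then .inr .lose else siftLoop i) =
        if g (.up i) = true then 0 else headsProd D H (i - 1) := by
      split_ifs
      · rfl
      · exact contValue_siftLoop D h1 h2
    have hup : upValue D H ℓ i = upValue D H ℓ (i + 1) * D (H i) := by
      rw [upValue, Finset.prod_eq_prod_Ico_succ_bot (by omega), upValue]
      ring
    simp only [hheads, htails]
    rw [hup, winRegValue_split D h1 h2 g (.up i) (Or.inl rfl)]
    exact round_value_le D (H i) (g (.up i)) (hreg i h1 h2)
  · simp only [SiftState.reg, winValue]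
    split_ifs with hi
    swap
    · simp
    obtain ⟨h1, h2⟩ := hi
    simp only [sift_forward_apply]
    rw [lintegral_comp_ite D (H i) fun x : (SiftState ⊕ Outcome) × (SiftReg → Bool) =>
      contValue SiftState.reg (winValue D H ℓ) 1 x.1 + winRegValue D H ℓ x.2]
    have htails : contValue SiftState.reg (winValue D H ℓ) 1
        (if g (.down i) = true then .inr .lose else siftLoop i) =
        if g (.down i) = true then 0 else headsProd D H (i - 1) := by
      split_ifs
      · rfl
      · exact contValue_siftLoop D h1 h2
    have hdown : headsProd D H i = headsProd D H (i - 1) * D (H i) := by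
      obtain ⟨i, rfl⟩ : ∃ i', i = i' + 1 := ⟨i - 1, by omega⟩
      exact headsProd_succ D i
    simp only [htails]
    rw [contValue_siftLoop D h1 h2, hdown, winRegValue_split D h1 h2 g (.down i) (Or.inr rfl)]
    exact round_value_le D (H i) (g (.down i)) (hreg i h1 h2)

/-- A call below `r` reaches `r` only through consecutive heads, and tails ends its chance of
writing `Up[r]`. At `i = r`, heads turns its value into the indicator; beyond `r` the call
contributes nothing. -/
theorem upWrittenValue_supermartingale {r : ℕ} (hr : r < ℓ) (q : SiftState)
    (g : SiftReg → Bool) :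
    ∫⁻ w, (contValue SiftState.reg (upWrittenValue D H r) 0 (((sift ℓ H).act q w).apply g).1 +
      if (((sift ℓ H).act q w).apply g).2 (.up r) = true then 1 else 0) ∂D ≤
      upWrittenValue D H r q.reg + if g (.up r) = true then 1 else 0 := by
  classical
  have hsum : ∀ i, D (H i) + D (H i)ᶜ = 1 := fun i => prob_add_prob_compl .of_discrete
  rcases q with i | i
  · simp only [sift_backward_apply]
    rw [lintegral_comp_ite D (H i) fun x : (SiftState ⊕ Outcome) × (SiftReg → Bool) =>
      contValue SiftState.reg (upWrittenValue D H r) 0 x.1 + if x.2 (.up r) = true then 1 else 0]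
    have htails : contValue SiftState.reg (upWrittenValue D H r) 0
        (if g (.up i) = true then .inr .lose else siftLoop i) = 0 := by
      split_ifs
      · rfl
      · exact contValue_upWrittenValue_siftLoop D r i
    simp only [htails, zero_add]
    rcases lt_trichotomy i r with hir | hir | hir
    · rw [if_neg (by omega)]
      simp only [Function.update_of_ne (show SiftReg.up r ≠ .up i by simpa using hir.ne')]
      simp only [contValue, SiftState.reg, upWrittenValue]
      rw [if_pos (show i + 1 ≤ r by omega), if_pos hir.le, Finset.prod_eq_prod_Ico_succ_bot (a := i) (by omega),
        add_mul, add_assoc, ← mul_add, hsum, mul_one, mul_comm]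
    · subst hir
      rw [if_neg (by omega)]
      simp only [Function.update_self]
      simp only [contValue, SiftState.reg, upWrittenValue]
      rw [if_neg (by omega), if_pos le_rfl, if_pos trivial]
      simp only [Nat.Ico_succ_singleton, Finset.prod_singleton, zero_add, one_mul]
      gcongr
      exact mul_le_of_le_one_right' prob_le_one
    · simp only [Function.update_of_ne (show SiftReg.up r ≠ .up i by simpa using hir.ne)]
      have hheads : contValue SiftState.reg (upWrittenValue D H r) 0
          (if i = ℓ then siftLoop i else .inl (.backward (i + 1))) = 0 := by
        split_ifs with hi
        · exact contValue_upWrittenValue_siftLoop D r i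
        · simp only [contValue, SiftState.reg, upWrittenValue]
          rw [if_neg (by omega)]
      rw [hheads, zero_add, ← mul_add, hsum, mul_one]
      exact le_add_self
  · simp only [sift_forward_apply]
    rw [lintegral_comp_ite D (H i) fun x : (SiftState ⊕ Outcome) × (SiftReg → Bool) =>
      contValue SiftState.reg (upWrittenValue D H r) 0 x.1 + if x.2 (.up r) = true then 1 else 0]
    have htails : contValue SiftState.reg (upWrittenValue D H r) 0
        (if g (.down i) = true then .inr .lose else siftLoop i) = 0 := by
      split_ifs
      · rfl
      · exact contValue_upWrittenValue_siftLoop D r i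
    simp only [htails, contValue_upWrittenValue_siftLoop, zero_add]
    simp only [Function.update_of_ne (show SiftReg.up r ≠ .down i by simp)]
    rw [← mul_add, hsum, mul_one]
    exact le_add_self

variable [Countable Ω] {M : Algo n Ω L V S} {A : Adversary n Ω L V SiftReg Bool} {k : ℕ}
  {E : List (Record n Ω L V SiftReg Bool)}

theorem cond_univ_le_one {α : Type*} [MeasurableSpace α] (μ : Measure α) (s : Set α) :
    cond μ s Set.univ ≤ 1 := by
  rw [ProbabilityTheory.cond, Measure.smul_apply, Measure.restrict_apply_univ, smul_eq_mul]
  exact ENNReal.inv_mul_le_one _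

/-- The expected number of winners. -/
theorem RWOblivious.lintegral_winners_le (hM : OneTime (sift ℓ H) M)
    (hA : RWOblivious (sift ℓ H) M A) (hℓ : 1 ≤ ℓ) (hH : ∀ i, 1 ≤ i → i ≤ ℓ → D (H i) ≠ 0)
    (hE : E ∈ Exec (sift ℓ H) M A k) :
    ∫⁻ ω, winners (sift ℓ H) M A ω
        ∂(cond (Measure.infinitePi fun _ : ℕ => D) (extensionEvent (sift ℓ H) M A E)) ≤
      k * upValue D H ℓ 1 + 2 * ∑ i ∈ Finset.Icc 1 ℓ, regValue D H i := by
  have hmono : Monotone fun t ω =>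
      ∑ p, resultValue 1 ((advRun (sift ℓ H) M A ω t).result p) := by
    intro s t hst ω
    refine Finset.sum_le_sum fun p _ => ?_
    rcases h : (advRun (sift ℓ H) M A ω s).result p with _ | (_ | _)
    · exact zero_le
    · rw [hM.result_advRun_mono A ω hst h]
    · exact zero_le
  have hwin : ∀ ω, winners (sift ℓ H) M A ω ≤
      ⨆ t, ∑ p, resultValue 1 ((advRun (sift ℓ H) M A ω t).result p) := by
    intro ω
    -- There are finitely many processes and results are permanent, so all winners are present at
    -- one finite time. Monotone convergence then reduces the bound to fixed times.
    have hex : ∃ t, ∀ p, (∃ s, (advRun (sift ℓ H) M A ω s).result p = some .win) →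
        (advRun (sift ℓ H) M A ω t).result p = some .win := by
      have : ∀ p, ∃ t, (∃ s, (advRun (sift ℓ H) M A ω s).result p = some .win) →
          (advRun (sift ℓ H) M A ω t).result p = some .win := by
        intro p
        by_cases h : ∃ s, (advRun (sift ℓ H) M A ω s).result p = some .win
        · exact ⟨h.choose, fun _ => h.choose_spec⟩
        · exact ⟨0, fun h' => absurd h' h⟩
      choose τ hτ using this
      exact ⟨Finset.univ.sup τ, fun p hp =>
        hM.result_advRun_mono A ω (Finset.le_sup (Finset.mem_univ p)) (hτ p hp)⟩
    obtain ⟨t, ht⟩ := hex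
    refine le_iSup_of_le t ?_
    classical
    have hset : {p | ∃ s, (advRun (sift ℓ H) M A ω s).result p = some .win} =
        ((Finset.univ.filter fun p => (advRun (sift ℓ H) M A ω t).result p = some .win :
          Finset (Fin n)) : Set (Fin n)) := by
      ext p
      simpa using ⟨fun h => ht p h, fun h => ⟨t, h⟩⟩
    rw [winners, hset, Set.ncard_coe_finset, Finset.card_filter, Nat.cast_sum]
    refine Finset.sum_le_sum fun p _ => ?_
    split_ifs with h
    · rw [h]
      simp [resultValue]
    · simp
  refine (lintegral_mono hwin).trans ?_
  rw [lintegral_iSup (fun t => measurable_comp_advRun t fun c => ∑ p, resultValue 1 (c.result p))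
    hmono]
  refine iSup_le fun t => ?_
  -- The potential bound is available only from time `E.length` on; monotonicity allows passing to a
  -- later time.
  refine (lintegral_mono (hmono (le_max_left t E.length))).trans ?_
  refine le_trans (lintegral_mono fun ω => ?_) ((hA.lintegral_cond_le D hM sift_act_reg
    (winValue_supermartingale D hH) hE (le_max_right t E.length)).trans ?_)
  · exact le_self_add
  · simp only [sift, SiftState.reg, winValue, winRegValue]
    rw [if_pos ⟨le_rfl, hℓ⟩]
    simp [two_mul]

/-- The probability that `Up[r]` is written. -/
theorem RWOblivious.lintegral_upWritten_le (hM : OneTime (sift ℓ H) M)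
    (hA : RWOblivious (sift ℓ H) M A) {r : ℕ} (h1 : 1 ≤ r) (hr : r < ℓ)
    (hE : E ∈ Exec (sift ℓ H) M A k) {t : ℕ} (ht : E.length ≤ t) :
    ∫⁻ ω, (if (advRun (sift ℓ H) M A ω t).gmem (.up r) = true then 1 else 0)
        ∂(cond (Measure.infinitePi fun _ : ℕ => D) (extensionEvent (sift ℓ H) M A E)) ≤
      k * headsProd D H r := by
  refine le_trans (lintegral_mono fun ω => ?_) ((hA.lintegral_cond_le D hM sift_act_reg
    (γ := fun g => if g (.up r) = true then 1 else 0)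
    (upWrittenValue_supermartingale D hr) hE ht).trans ?_)
  · exact le_add_self
  · simp only [sift, SiftState.reg, upWrittenValue]
    rw [if_pos h1]
    simp [headsProd]

/-- The expected maximum number of steps. -/
theorem RWOblivious.lintegral_maxSteps_le (hM : OneTime (sift ℓ H) M)
    (hA : RWOblivious (sift ℓ H) M A) (hℓ : 1 ≤ ℓ) (hE : E ∈ Exec (sift ℓ H) M A k) :
    ∫⁻ ω, maxSteps (sift ℓ H) M A ω
        ∂(cond (Measure.infinitePi fun _ : ℕ => D) (extensionEvent (sift ℓ H) M A E)) ≤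
      1 + 2 * ∑ r ∈ Finset.Ico 1 ℓ, min 1 (k * headsProd D H r) := by
  set P := cond (Measure.infinitePi fun _ : ℕ => D) (extensionEvent (sift ℓ H) M A E)
  let ind : ℕ → ℕ → (ℕ → Ω) → ℝ≥0∞ := fun t r ω =>
    if (advRun (sift ℓ H) M A ω t).gmem (.up r) = true then 1 else 0
  have hind : ∀ t r, Measurable (ind t r) := fun t r =>
    measurable_comp_advRun t fun c : Config n Ω L V S SiftState SiftReg Bool =>
      if c.gmem (.up r) = true then (1 : ℝ≥0∞) else 0
  have hmono : Monotone fun t ω => 1 + 2 * ∑ r ∈ Finset.Ico 1 ℓ, ind t r ω := by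
    intro s t hst ω
    dsimp only
    gcongr with r hr
    simp only [ind]
    split_ifs with h1 h2
    · exact le_rfl
    · exact absurd (hM.gmem_advRun_mono A ω hst h1) h2
    · exact zero_le
    · exact le_rfl
  have hmax : ∀ ω, maxSteps (sift ℓ H) M A ω ≤
      ⨆ t, (1 + 2 * ∑ r ∈ Finset.Ico 1 ℓ, ind t r ω) := by
    intro ω
    refine iSup_le fun p => iSup_le fun t => le_iSup_of_le t ?_
    refine (Nat.cast_le.2 (hM.steps_le hℓ A ω t p)).trans (le_of_eq ?_)
    simp [upCount, ind]
  refine (lintegral_mono hmax).trans ?_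
  rw [lintegral_iSup (fun t => by fun_prop) hmono]
  refine iSup_le fun t => ?_
  refine (lintegral_mono (hmono (le_max_left t E.length))).trans ?_
  rw [lintegral_add_left measurable_const, lintegral_const_mul _ (by fun_prop),
    lintegral_finsetSum _ fun r _ => hind _ r, lintegral_const, one_mul]
  gcongr with r hr
  · exact cond_univ_le_one _ _
  · rw [Finset.mem_Ico] at hr
    refine le_min ?_ (hA.lintegral_upWritten_le D hM hr.1 hr.2 hE (le_max_right _ _))
    refine le_trans (lintegral_mono (g := fun _ => 1) fun ω => ?_) ?_
    · simp only [ind]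
      split_ifs <;> simp
    · rw [lintegral_const, one_mul]
      exact cond_univ_le_one _ _

end SiftPotential

/-! ### Numerical estimates -/

section Numerics

theorem headsProb_eq (i : ℕ) : headsProb i = 2 ^ (-(3 / 2 : ℝ) ^ (i - 1)) := by
  rw [headsProb, Real.rpow_neg (by norm_num), one_div]

theorem headsProb_pos (i : ℕ) : 0 < headsProb i := by
  rw [headsProb_eq]
  positivity

theorem one_add_half_le_pow (j : ℕ) : 1 + (j : ℝ) / 2 ≤ (3 / 2 : ℝ) ^ j := by
  have := one_add_mul_le_pow (a := (1 / 2 : ℝ)) (by norm_num) j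
  norm_num at this ⊢
  linarith

/-- Bernoulli's inequality makes the doubly exponential decay at least geometric with ratio
`2^(-1/2) < 0.71`; the series then sums to at most `50/29 < 7/4`. -/
theorem headsProb_succ_le (j : ℕ) : headsProb (j + 1) ≤ 1 / 2 * (71 / 100) ^ j := by
  have h2 : (2 : ℝ) ^ (-(1 / 2) : ℝ) ≤ 71 / 100 := by
    rw [Real.rpow_neg (by norm_num), ← Real.sqrt_eq_rpow]
    refine inv_le_of_inv_le₀ (by norm_num) (Real.le_sqrt_of_sq_le ?_)
    norm_num
  calc headsProb (j + 1) ≤ 2 ^ (-1 + -(1 / 2) * (j : ℝ)) := by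
        rw [headsProb_eq, Nat.add_sub_cancel]
        refine Real.rpow_le_rpow_of_exponent_le (by norm_num) ?_
        linarith [one_add_half_le_pow j]
    _ = 1 / 2 * (2 ^ (-(1 / 2) : ℝ)) ^ j := by
        rw [Real.rpow_add (by norm_num), Real.rpow_mul (by norm_num), Real.rpow_natCast,
          Real.rpow_neg_one, one_div]
    _ ≤ _ := by gcongr

theorem sum_headsProb_le (ℓ : ℕ) : ∑ i ∈ Finset.Icc 1 ℓ, headsProb i ≤ 7 / 4 := by
  have hsum : ∑ i ∈ Finset.Icc 1 ℓ, headsProb i = ∑ j ∈ Finset.range ℓ, headsProb (j + 1) := by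
    rw [Finset.range_eq_Ico, Finset.sum_Ico_add' (fun i => headsProb i) 0 ℓ 1]
    rfl
  rw [hsum]
  calc _ ≤ ∑ j ∈ Finset.range ℓ, 1 / 2 * (71 / 100 : ℝ) ^ j :=
        Finset.sum_le_sum fun j _ => headsProb_succ_le j
    _ = 1 / 2 * ∑ j ∈ Finset.range ℓ, (71 / 100 : ℝ) ^ j := by rw [Finset.mul_sum]
    _ ≤ 7 / 4 := by
        rw [geom_sum_eq (by norm_num)]
        have : (0 : ℝ) ≤ (71 / 100 : ℝ) ^ ℓ := by positivity
        linarith [show ((71 / 100 : ℝ) ^ ℓ - 1) / (71 / 100 - 1) =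
          (1 - (71 / 100 : ℝ) ^ ℓ) * (100 / 29) by ring]

theorem logb_le_pow {K m : ℕ} (hK : 2 ≤ K)
    (hm : ⌈Real.logb (3 / 2) (Real.logb 2 K)⌉₊ ≤ m) : Real.logb 2 K ≤ (3 / 2 : ℝ) ^ m := by
  have hpos : 0 < Real.logb 2 K := Real.logb_pos (by norm_num) (by exact_mod_cast hK)
  have h := (Nat.le_ceil _).trans (Nat.cast_le (α := ℝ).2 hm)
  rwa [Real.logb_le_iff_le_rpow (by norm_num) hpos, Real.rpow_natCast] at h

theorem one_le_logb {K : ℕ} (hK : 2 ≤ K) : 1 ≤ Real.logb 2 K := by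
  rw [Real.le_logb_iff_rpow_le (by norm_num) (by positivity), Real.rpow_one]
  exact_mod_cast hK

/-- The expected number of processes that choose heads in the first `m + s` rounds. -/
theorem mul_two_rpow_le {k K m : ℕ} (hkK : k ≤ K) (hK : 2 ≤ K)
    (hm : ⌈Real.logb (3 / 2) (Real.logb 2 K)⌉₊ ≤ m) (s : ℕ) :
    (k : ℝ) * 2 ^ (2 - 2 * (3 / 2 : ℝ) ^ (m + s)) ≤ 2 * (1 / 2) ^ s := by
  have h1 := logb_le_pow hK hm
  have h2 := one_le_logb hK
  have h3 := one_add_half_le_pow s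
  have hK0 : (0 : ℝ) < K := by positivity
  calc (k : ℝ) * 2 ^ (2 - 2 * (3 / 2 : ℝ) ^ (m + s))
      ≤ K * 2 ^ (2 - 2 * (3 / 2 : ℝ) ^ (m + s)) := by gcongr
    _ = 2 ^ (Real.logb 2 K + (2 - 2 * (3 / 2 : ℝ) ^ (m + s))) := by
        rw [Real.rpow_add (by norm_num), Real.rpow_logb (by norm_num) (by norm_num) hK0]
    _ ≤ 2 ^ (1 + -(s : ℝ)) := by
        refine Real.rpow_le_rpow_of_exponent_le (by norm_num) ?_
        rw [pow_add]
        have h4 : Real.logb 2 K * (3 / 2 : ℝ) ^ s ≤ (3 / 2 : ℝ) ^ m * (3 / 2 : ℝ) ^ s := by gcongr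
        -- With `λ = log₂ K ≥ 1`, the exponent is at most `λ (1 - 2 (3/2)^s) + 2`, which is largest
        -- at `λ = 1`, where it equals `3 - 2 (3/2)^s ≤ 1 - s`.
        have h5 : 0 ≤ (Real.logb 2 K - 1) * (2 * (3 / 2 : ℝ) ^ s - 1) := by
          refine mul_nonneg (by linarith) ?_
          have : (0 : ℝ) ≤ s := by positivity
          linarith
        nlinarith
    _ = _ := by
        rw [Real.rpow_add (by norm_num), Real.rpow_neg (by norm_num), Real.rpow_natCast,
          Real.rpow_one, one_div, inv_pow]

/-- For `m ≥ 1`, the indices below `m` give at most `m - 1` and the geometric tail at most `4`. The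
term `2 (1/2)^s` in the induction is the unused remainder of that tail. -/
theorem sum_min_le {a : ℕ → ℝ} {m : ℕ} (h1 : ∀ r, a r ≤ 1)
    (h2 : ∀ s, a (m + s) ≤ 2 * (1 / 2) ^ s) (N : ℕ) :
    ∑ r ∈ Finset.Ico 1 N, a r ≤ m + 3 := by
  have key : ∀ N, 1 ≤ N → (N ≤ m → ∑ r ∈ Finset.Ico 1 N, a r ≤ N - 1) ∧
      ∀ s, N = m + s + 1 → ∑ r ∈ Finset.Ico 1 N, a r ≤ m + 3 - 2 * (1 / 2 : ℝ) ^ s := by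
    intro N hN
    induction N, hN using Nat.le_induction with
    | base =>
      refine ⟨fun _ => by simp, fun s hs => ?_⟩
      have hs0 : s = 0 := by omega
      subst hs0
      have : (0 : ℝ) ≤ m := by positivity
      simp only [Finset.Ico_self, Finset.sum_empty, pow_zero]
      linarith
    | succ N hN ih =>
      rw [Finset.sum_Ico_succ_top hN]
      refine ⟨fun h => ?_, fun s hs => ?_⟩
      · have := ih.1 (by omega)
        push_cast
        linarith [h1 N]
      · have hNs : N = m + s := by omega
        have h3 := h2 s
        rw [← hNs] at h3
        rcases s with _ | s
        · have h4 := ih.1 (by omega)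
          have h5 : (N : ℝ) = m := by rw [hNs]; simp
          simp only [pow_zero] at h3 ⊢
          linarith
        · have h4 := ih.2 s (by omega)
          rw [pow_succ] at h3 ⊢
          linarith
  rcases Nat.lt_or_ge N 1 with hN | hN
  · rw [Finset.Ico_eq_empty (by omega)]
    simp only [Finset.sum_empty]
    positivity
  · rcases Nat.lt_or_ge m N with hmN | hmN
    · have h := (key N hN).2 (N - m - 1) (by omega)
      have : (0 : ℝ) ≤ (1 / 2 : ℝ) ^ (N - m - 1) := by positivity
      linarith
    · have h := (key N hN).1 hmN
      have : (N : ℝ) ≤ m := by exact_mod_cast hmN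
      linarith

variable {Ω : Type*} [MeasurableSpace Ω] {D : Measure Ω} {H : ℕ → Set Ω} {ℓ : ℕ}

/-- The exponents form a geometric sum: `∑_{j<i} (3/2)^j = 2 (3/2)^i - 2`. -/
theorem headsProd_eq (hH : ∀ i, 1 ≤ i → i ≤ ℓ → D (H i) = ENNReal.ofReal (headsProb i)) {i : ℕ}
    (hi : i ≤ ℓ) : headsProd D H i = ENNReal.ofReal (2 ^ (2 - 2 * (3 / 2 : ℝ) ^ i)) := by
  induction i with
  | zero => simp [headsProd_zero]
  | succ i ih =>
    rw [headsProd_succ, ih (by omega), hH _ (by omega) hi, ← ENNReal.ofReal_mul (by positivity),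
      headsProb_eq, Nat.add_sub_cancel, ← Real.rpow_add (by norm_num)]
    congr 2
    rw [pow_succ]
    ring

/-- Dividing `2^(2 - 2x)` by `2^(-x)`, where `x = (3/2)^(i-1)`, leaves `4 · 2^(-x)`. So the deposits
are summable uniformly in `ℓ`. -/
theorem regValue_eq (hH : ∀ i, 1 ≤ i → i ≤ ℓ → D (H i) = ENNReal.ofReal (headsProb i)) {i : ℕ}
    (h1 : 1 ≤ i) (hi : i ≤ ℓ) : regValue D H i = ENNReal.ofReal (4 * headsProb i) := by
  rw [regValue, headsProd_eq hH (show i - 1 ≤ ℓ by omega), hH i h1 hi,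
    ← ENNReal.ofReal_div_of_pos (headsProb_pos i)]
  congr 1
  rw [headsProb_eq, div_eq_iff (by positivity), mul_assoc, ← Real.rpow_add (by norm_num),
    show (4 : ℝ) = 2 ^ (2 : ℝ) by norm_num, ← Real.rpow_add (by norm_num)]
  congr 1
  ring

theorem headsProd_le_one [IsProbabilityMeasure D] (i : ℕ) : headsProd D H i ≤ 1 :=
  Finset.prod_le_one' fun _ _ => prob_le_one

theorem one_le_arrayLen (n : ℕ) : 1 ≤ arrayLen n := le_max_left _ _

theorem upValue_le [IsProbabilityMeasure D] {n k : ℕ} (hk : k ≤ n)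
    (hH : ∀ i, 1 ≤ i → i ≤ arrayLen n → D (H i) = ENNReal.ofReal (headsProb i)) :
    k * upValue D H (arrayLen n) 1 ≤ 2 := by
  have hle : (k : ℝ≥0∞) * upValue D H (arrayLen n) 1 ≤
      ENNReal.ofReal (k * 2 ^ (2 - 2 * (3 / 2 : ℝ) ^ arrayLen n)) := by
    rw [ENNReal.ofReal_mul (by positivity), ENNReal.ofReal_natCast, ← headsProd_eq hH le_rfl]
    gcongr
    calc upValue D H (arrayLen n) 1 ≤ headsProd D H (arrayLen n) * 1 := by
          rw [upValue, ← headsProd]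
          gcongr
          exact headsProd_le_one _
      _ = _ := mul_one _
  refine hle.trans ?_
  rw [show (2 : ℝ≥0∞) = ENNReal.ofReal 2 by simp]
  refine ENNReal.ofReal_le_ofReal ?_
  rcases Nat.lt_or_ge n 2 with hn | hn
  -- For `n < 2` the iterated logarithm gives no information, but there is at most one process.
  · have hk1 : (k : ℝ) ≤ 1 := by exact_mod_cast (show k ≤ 1 by omega)
    have hp : (2 : ℝ) ^ (2 - 2 * (3 / 2 : ℝ) ^ arrayLen n) ≤ 1 := by
      refine Real.rpow_le_one_of_one_le_of_nonpos (by norm_num) ?_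
      have : (1 : ℝ) ≤ (3 / 2 : ℝ) ^ arrayLen n := one_le_pow₀ (by norm_num)
      linarith
    nlinarith [Real.rpow_nonneg (show (0 : ℝ) ≤ 2 by norm_num)
      (2 - 2 * (3 / 2 : ℝ) ^ arrayLen n)]
  · simpa using mul_two_rpow_le hk hn (m := arrayLen n) (le_max_right 1 _) 0

theorem winners_bound [IsProbabilityMeasure D] {n k : ℕ} (hk : k ≤ n)
    (hH : ∀ i, 1 ≤ i → i ≤ arrayLen n → D (H i) = ENNReal.ofReal (headsProb i)) :
    k * upValue D H (arrayLen n) 1 + 2 * ∑ i ∈ Finset.Icc 1 (arrayLen n), regValue D H i ≤ 16 := by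
  have hsum : ∑ i ∈ Finset.Icc 1 (arrayLen n), regValue D H i ≤ 7 := by
    rw [Finset.sum_congr rfl fun i hi =>
      regValue_eq hH (Finset.mem_Icc.1 hi).1 (Finset.mem_Icc.1 hi).2,
      ← ENNReal.ofReal_sum_of_nonneg fun i _ => by linarith [headsProb_pos i], ← Finset.mul_sum,
      show (7 : ℝ≥0∞) = ENNReal.ofReal 7 by simp]
    refine ENNReal.ofReal_le_ofReal ?_
    linarith [sum_headsProb_le (arrayLen n)]
  calc _ ≤ (2 : ℝ≥0∞) + 2 * 7 := add_le_add (upValue_le hk hH) (by gcongr)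
    _ = 16 := by norm_num

theorem steps_bound {k : ℕ}
    (hH : ∀ i, 1 ≤ i → i ≤ ℓ → D (H i) = ENNReal.ofReal (headsProb i)) :
    1 + 2 * ∑ r ∈ Finset.Ico 1 ℓ, min 1 (k * headsProd D H r) ≤
      ((2 * ⌈Real.logb (3 / 2) (Real.logb 2 (max k 2 : ℕ))⌉₊ + 7 : ℕ) : ℝ≥0∞) := by
  set m := ⌈Real.logb (3 / 2) (Real.logb 2 (max k 2 : ℕ))⌉₊ with hm
  let a : ℕ → ℝ := fun r => min 1 (k * 2 ^ (2 - 2 * (3 / 2 : ℝ) ^ r))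
  have ha : ∑ r ∈ Finset.Ico 1 ℓ, a r ≤ m + 3 :=
    sum_min_le (fun r => min_le_left _ _) (fun s => (min_le_right _ _).trans
      (mul_two_rpow_le (le_max_left k 2) (le_max_right k 2) hm.ge s)) ℓ
  have hsum : ∑ r ∈ Finset.Ico 1 ℓ, min 1 (k * headsProd D H r) ≤ ((m + 3 : ℕ) : ℝ≥0∞) := by
    have : ∀ r ∈ Finset.Ico 1 ℓ, min 1 (k * headsProd D H r) = ENNReal.ofReal (a r) := by
      intro r hr
      rw [headsProd_eq hH (Finset.mem_Ico.1 hr).2.le, ENNReal.ofReal_min, ENNReal.ofReal_one,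
        ENNReal.ofReal_mul (by positivity), ENNReal.ofReal_natCast]
    rw [Finset.sum_congr rfl this, ← ENNReal.ofReal_sum_of_nonneg fun r _ => by positivity,
      ← ENNReal.ofReal_natCast]
    refine ENNReal.ofReal_le_ofReal ?_
    push_cast
    exact ha
  calc _ ≤ 1 + 2 * ((m + 3 : ℕ) : ℝ≥0∞) := by gcongr
    _ = ((1 + 2 * (m + 3) : ℕ) : ℝ≥0∞) := by push_cast; rfl
    _ = _ := by congr 1; ring

theorem ceil_logb_bound {k : ℕ} (hk : 3 ≤ k) :
    ((2 * ⌈Real.logb (3 / 2) (Real.logb 2 (max k 2 : ℕ))⌉₊ + 7 : ℕ) : ℝ) ≤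
      11 * (Real.log 2 / Real.log (3 / 2)) * Real.logb 2 (Real.logb 2 k) := by
  rw [max_eq_left (by omega : 2 ≤ k)]
  -- Since `2√2 ≤ 3 ≤ k`, the iterated logarithm `z` to base `3/2` is at least `1`. This absorbs the
  -- additive constants: `2 ⌈z⌉ + 7 ≤ 2 z + 9 ≤ 11 z`.
  have hlog : 3 / 2 ≤ Real.logb 2 k := by
    rw [Real.le_logb_iff_rpow_le (by norm_num) (by positivity)]
    have h3 : (3 : ℝ) ≤ k := by exact_mod_cast hk
    refine le_trans ?_ h3
    rw [show (3 / 2 : ℝ) = 1 + 1 / 2 by norm_num, Real.rpow_add (by norm_num), Real.rpow_one,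
      ← Real.sqrt_eq_rpow]
    have : √2 ≤ 3 / 2 := Real.sqrt_le_iff.2 ⟨by norm_num, by norm_num⟩
    linarith
  set z := Real.logb (3 / 2) (Real.logb 2 k) with hz
  have hz1 : 1 ≤ z := by
    rw [hz, Real.le_logb_iff_rpow_le (by norm_num) (by linarith), Real.rpow_one]
    exact hlog
  have hzeq : Real.log 2 / Real.log (3 / 2) * Real.logb 2 (Real.logb 2 k) = z := by
    rw [hz, ← Real.log_div_log, ← Real.log_div_log (b := 3 / 2)]
    have : Real.log 2 ≠ 0 := (Real.log_pos (by norm_num)).ne'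
    field_simp
  rw [mul_assoc, hzeq]
  have := Nat.ceil_lt_add_one (show 0 ≤ z by linarith)
  push_cast
  linarith

end Numerics

end GroupElect

/-! ### The group election lemma -/

theorem lemma3p5 :
    ∃ C : ℝ, ∀ (n : ℕ) (Ω : Type*) [Countable Ω] [MeasurableSpace Ω] [DiscreteMeasurableSpace Ω]
      (D : MeasureTheory.Measure Ω) [MeasureTheory.IsProbabilityMeasure D] (H : ℕ → Set Ω),
      (∀ i, 1 ≤ i → i ≤ GroupElect.arrayLen n →
        D (H i) = ENNReal.ofReal (GroupElect.headsProb i)) →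
      ∀ (L V S : Type*) (M : GroupElect.Algo n Ω L V S),
        GroupElect.OneTime (GroupElect.sift (GroupElect.arrayLen n) H) M →
        GroupElect.NotAllLose (GroupElect.sift (GroupElect.arrayLen n) H) M ∧
        ∀ A : GroupElect.Adversary n Ω L V GroupElect.SiftReg Bool,
          GroupElect.RWOblivious (GroupElect.sift (GroupElect.arrayLen n) H) M A →
          ∀ k : ℕ, 1 ≤ k → k ≤ n →
            GroupElect.effectiveness D (GroupElect.sift (GroupElect.arrayLen n) H) M A k ≤ 16 ∧
            GroupElect.expMaxStep D (GroupElect.sift (GroupElect.arrayLen n) H) M A k ≤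
              ((2 * ⌈Real.logb (3 / 2) (Real.logb 2 (max k 2 : ℕ))⌉₊ + 7 : ℕ) : ENNReal) ∧
            (3 ≤ k →
              GroupElect.expMaxStep D (GroupElect.sift (GroupElect.arrayLen n) H) M A k ≤
                ENNReal.ofReal (C * Real.logb 2 (Real.logb 2 k))) := by
  refine ⟨11 * (Real.log 2 / Real.log (3 / 2)), ?_⟩
  intro n Ω _ _ _ D _ H hH L V S M hM
  have hℓ := GroupElect.one_le_arrayLen n
  refine ⟨hM.notAllLose hℓ, fun A hA k _ hk => ?_⟩
  have hne : ∀ i, 1 ≤ i → i ≤ GroupElect.arrayLen n → D (H i) ≠ 0 := fun i h1 h2 => by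
    rw [hH i h1 h2]
    exact (ENNReal.ofReal_pos.2 (GroupElect.headsProb_pos i)).ne'
  have hsteps : GroupElect.expMaxStep D (GroupElect.sift (GroupElect.arrayLen n) H) M A k ≤
      ((2 * ⌈Real.logb (3 / 2) (Real.logb 2 (max k 2 : ℕ))⌉₊ + 7 : ℕ) : ENNReal) :=
    iSup₂_le fun E hE =>
      (hA.lintegral_maxSteps_le D hM hℓ hE).trans (GroupElect.steps_bound hH)
  refine ⟨iSup₂_le fun E hE => (hA.lintegral_winners_le D hM hℓ hne hE).trans
    (GroupElect.winners_bound hk hH), hsteps, fun h3 => hsteps.trans ?_⟩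
  rw [← ENNReal.ofReal_natCast]
  exact ENNReal.ofReal_le_ofReal (GroupElect.ceil_logb_bound h3)
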